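/- **Model.** $n$ processes, labelled $0,\dots,n-1$ (each process knows its own label), share a multiple access channel and work in synchronous rounds. Each process cyclically executes the sections *remainder*, *entry*, *critical*, *exit*, starting in the remainder section; in each round it is in exactly one section, and every run of a section lasts at least one round. An adversary fixes, for each process, a finite or infinite sequence of pairs of positive integers, namely the lengths of its successive remainder and critical sections; after the last pair of a finite sequence (and the exit section that follows) the process stays in the remainder section forever. A *deterministic algorithm* controls the entry and exit sections: in each round of such a section a process, depending on its local state only, either transmits a message (of arbitrary content) or listens; then it updates its local state depending on what it heard and decides whether to leave the section. The local state is initially determined by the label alone (or by the label and $n$, see below), may be updated by an arbitrary function, and is unchanged during remainder and critical sections. A process in the remainder section does not transmit; a process in the critical section transmits a message labelled "critical" in every round. A transmitting process hears nothing. A listening process hears the message if exactly one process transmits, and silence if none does; if at least two transmit, it hears a collision, distinguishable from silence, in the model *with collision detection*, and it hears silence in the model without. There is no global clock. An algorithm *solves mutual exclusion* if in every execution: at most one process is in the critical section in each round (exclusion); a process in the exit section eventually switches to the remainder section (unobstructed exit); and if some process is in the entry section, then some process eventually enters the critical section (no deadlock). It has the *no-lockout* property if every process in the entry section eventually enters the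 critical section itself. Its *makespan* for $n$ processes is the maximum, over all executions with $n$ processes, of the length of a time interval in which some process is in the entry section and no process is in the critical section. **Corollary.** (1) In the model with collision detection, without a global clock and without knowledge of $n$, there is a single deterministic algorithm that, for every number $n$ of processes, solves mutual exclusion with the no-lockout property and has finite makespan, the makespan being $O(\log n)$ as $n\to\infty$. (2) In the model with known $n$, without collision detection and without a global clock, there is a family of deterministic algorithms, one for each $n$, such that the $n$-th algorithm, run by $n$ processes, solves mutual exclusion with the no-lockout property and has finite makespan, the makespan being $O(n\log^2 n)$ as $n\to\infty$. -/

import Mathlib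

open Filter Asymptotics

namespace MutexMAC

/-- The four sections that every process executes cyclically. -/
inductive Sec
  | remainder
  | entry
  | critical
  | exit

/-- What an algorithm lets a process do on the channel in one round of an entry or exit section. -/
inductive Action (M : Type)
  | transmit (m : M)
  | listen

/-- A transmitted message: either one labelled critical, or a regular message of an algorithm. -/
inductive Signal (M : Type)
  | critical
  | regular (m : M)

/-- The state of the channel in one round: no transmitter, exactly one, or at least two. -/
inductive Feedback (M : Type)
  | silence
  | message (s : Signal M)
  | collision

/-- A deterministic algorithm for the entry and exit sections. The process labelled `p` starts its
first entry section in the local state `init p`, which is all it knows initially. In each round of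
an entry (exit) section a process acts according to its local state; then, given what it heard
(`none` if it transmitted in this round, `some f` if it listened), it updates its state and decides
whether this was the last round of the section (`true`) or not (`false`). -/
structure Algorithm where
  Msg : Type
  State : Type
  init : ℕ → State
  entryAction : State → Action Msg
  entryStep : State → Option (Feedback Msg) → State × Bool
  exitAction : State → Action Msg
  exitStep : State → Option (Feedback Msg) → State × Bool

/-- An adversarial strategy against `n` processes: for each process a finite or infinite sequence of
pairs (length of a remainder section, length of the next critical section). After the last critical
section of a finite sequence, and its exit section, the process stays in the remainder section. -/
abbrev Strategy (n : ℕ) : Type := Fin n → Stream'.Seq (ℕ+ × ℕ+)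

/-- The situation of one process in one round: its section, the local state of the algorithm, the
number of complete cycles it has performed, and the number of earlier rounds of the current run of
its section. -/
structure Config (S : Type) where
  sec : Sec
  state : S
  cycle : ℕ
  elapsed : ℕ

/-- The message that a process transmits in a round, if any. -/
def transmission (A : Algorithm) (c : Config A.State) : Option (Signal A.Msg) :=
  match c.sec with
  | .remainder => none
  | .critical => some .critical
  | .entry =>
    match A.entryAction c.state with
    | .transmit m => some (.regular m)
    | .listen => none
  | .exit =>
    match A.exitAction c.state with
    | .transmit m => some (.regular m)
    | .listen => none

/-- The outcome on the channel when process `p` transmits `tx p` (nothing if `tx p = none`). -/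
def channel {M : Type} {n : ℕ} (tx : Fin n → Option (Signal M)) : Feedback M :=
  match (List.finRange n).filterMap tx with
  | [] => .silence
  | [s] => .message s
  | _ => .collision

/-- What a listener perceives, with (`cd = true`) or without (`cd = false`) collision detection:
without it, a collision is perceived as silence. -/
def perceive {M : Type} (cd : Bool) : Feedback M → Feedback M
  | .collision => if cd then .collision else .silence
  | f => f

/-- What a process hears: nothing at all when it transmits itself. -/
def reception {M : Type} {n : ℕ} (cd : Bool) (tx : Fin n → Option (Signal M)) (p : Fin n) :
    Option (Feedback M) :=
  match tx p with
  | some _ => none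
  | none => some (perceive cd (channel tx))

/-- The transition of one process between two consecutive rounds, where `σ` is its sequence of
section lengths and `r` is what it heard. The algorithm's state is frozen during the remainder and
critical sections. (A process in its critical section always has `σ.get? c.cycle ≠ none`.) -/
def advance (A : Algorithm) (σ : Stream'.Seq (ℕ+ × ℕ+)) (r : Option (Feedback A.Msg))
    (c : Config A.State) : Config A.State :=
  match c.sec with
  | .remainder =>
    match σ.get? c.cycle with
    | none => { c with elapsed := c.elapsed + 1 }
    | some d =>
      if c.elapsed + 1 < (d.1 : ℕ) then { c with elapsed := c.elapsed + 1 }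
      else { c with sec := .entry, elapsed := 0 }
  | .entry =>
    let s := A.entryStep c.state r
    if s.2 then { c with sec := .critical, state := s.1, elapsed := 0 }
    else { c with state := s.1, elapsed := c.elapsed + 1 }
  | .critical =>
    match σ.get? c.cycle with
    | none => { c with sec := .exit, elapsed := 0 }
    | some d =>
      if c.elapsed + 1 < (d.2 : ℕ) then { c with elapsed := c.elapsed + 1 }
      else { c with sec := .exit, elapsed := 0 }
  | .exit =>
    let s := A.exitStep c.state r
    if s.2 then { sec := .remainder, state := s.1, cycle := c.cycle + 1, elapsed := 0 }
    else { c with state := s.1, elapsed := c.elapsed + 1 }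

/-- One synchronous round of the whole system. -/
def step (A : Algorithm) (cd : Bool) {n : ℕ} (σ : Strategy n) (c : Fin n → Config A.State) :
    Fin n → Config A.State :=
  fun p => advance A (σ p) (reception cd (fun q => transmission A (c q)) p) (c p)

/-- The execution of `A` by the processes `0, …, n - 1` against the strategy `σ`:
`run A cd σ t p` is the situation of process `p` in round `t`. -/
def run (A : Algorithm) (cd : Bool) {n : ℕ} (σ : Strategy n) : ℕ → Fin n → Config A.State
  | 0 => fun p => { sec := .remainder, state := A.init p, cycle := 0, elapsed := 0 }
  | t + 1 => step A cd σ (run A cd σ t)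

/-- The section in which process `p` is in round `t`. -/
def secAt (A : Algorithm) (cd : Bool) {n : ℕ} (σ : Strategy n) (t : ℕ) (p : Fin n) : Sec :=
  (run A cd σ t p).sec

/-- Process `p` enters the critical section between the rounds `t` and `t + 1`. -/
def EntersCritical (A : Algorithm) (cd : Bool) {n : ℕ} (σ : Strategy n) (t : ℕ) (p : Fin n) :
    Prop :=
  secAt A cd σ t p = .entry ∧ secAt A cd σ (t + 1) p = .critical

/-- At most one process is in the critical section in each round. -/
def Exclusion (A : Algorithm) (cd : Bool) {n : ℕ} (σ : Strategy n) : Prop :=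
  ∀ (t : ℕ) (p q : Fin n), secAt A cd σ t p = .critical → secAt A cd σ t q = .critical → p = q

/-- Every process in the exit section eventually switches to the remainder section. -/
def UnobstructedExit (A : Algorithm) (cd : Bool) {n : ℕ} (σ : Strategy n) : Prop :=
  ∀ (t : ℕ) (p : Fin n), secAt A cd σ t p = .exit → ∃ t' > t, secAt A cd σ t' p = .remainder

/-- If some process is in the entry section, then some process eventually enters the critical
section. -/
def NoDeadlock (A : Algorithm) (cd : Bool) {n : ℕ} (σ : Strategy n) : Prop :=
  ∀ (t : ℕ) (p : Fin n), secAt A cd σ t p = .entry → ∃ t' ≥ t, ∃ q, EntersCritical A cd σ t' q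

/-- Every process in the entry section eventually enters the critical section itself. -/
def NoLockout (A : Algorithm) (cd : Bool) {n : ℕ} (σ : Strategy n) : Prop :=
  ∀ (t : ℕ) (p : Fin n), secAt A cd σ t p = .entry → ∃ t' ≥ t, EntersCritical A cd σ t' p

/-- `A`, run by the processes `0, …, n - 1`, is a mutual exclusion algorithm. -/
def IsMutex (A : Algorithm) (cd : Bool) (n : ℕ) : Prop :=
  ∀ σ : Strategy n, Exclusion A cd σ ∧ UnobstructedExit A cd σ ∧ NoDeadlock A cd σ

/-- `A`, run by the processes `0, …, n - 1`, satisfies the no-lockout property. -/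
def IsFair (A : Algorithm) (cd : Bool) (n : ℕ) : Prop :=
  ∀ σ : Strategy n, NoLockout A cd σ

/-- In round `t` some process is in the entry section and none is in the critical section. -/
def Waiting (A : Algorithm) (cd : Bool) {n : ℕ} (σ : Strategy n) (t : ℕ) : Prop :=
  (∃ p, secAt A cd σ t p = .entry) ∧ ∀ p, secAt A cd σ t p ≠ .critical

/-- The makespan of an execution: the supremum of the lengths `ℓ` of the time intervals
`a, …, a + ℓ - 1` in which some process is in the entry section and none in the critical section. -/
noncomputable def execMakespan (A : Algorithm) (cd : Bool) {n : ℕ} (σ : Strategy n) : ℕ∞ :=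
  ⨆ (a : ℕ) (ℓ : ℕ) (_ : ∀ t, a ≤ t → t < a + ℓ → Waiting A cd σ t), (ℓ : ℕ∞)

/-- The makespan of `A` when run by the processes `0, …, n - 1`. -/
noncomputable def makespan (A : Algorithm) (cd : Bool) (n : ℕ) : ℕ∞ :=
  ⨆ σ : Strategy n, execMakespan A cd σ

end MutexMAC

/-! Both algorithms are analysed as global phase systems. In every round the joint configuration
satisfies the invariant of some phase, a rank of phases strictly decreases in waiting rounds, and a
lexicographic measure attached to each process in its entry section decreases until that process
enters its critical section. `correct_of_phases` turns such data into exclusion, no deadlock, no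
lockout and a makespan bound; exit sections last one round.

With collision detection, candidates run an election by code words: a 1 means transmit, a 0 means
listen, and whoever listens and hears anything but silence loses. The survivors therefore always
share a common prefix, and prefix-freeness makes the first one to finish its word the only survivor.
Words have a 1 in every even position, so two silent rounds in a row never occur during an election;
requiring two silent rounds before joining keeps newcomers out. The losers hold a new election among
themselves when the winner exits, so a batch of contenders only shrinks until it is used up, which
excludes lockout. Words of length O(log p) for label p give makespan O(log n), without knowledge of
n.

Without collision detection, contenders start fixed schedules after m silent rounds, at times that
the adversary influences. A synchronizer guarantees a round with a single transmitter before the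
earliest starter finishes its m rounds. Everybody else hears this transmission and resets, so the
lone transmitter finishes before anyone else can become active. Lockout is excluded by a round
robin: an exiting process announces its label, and each waiting process enters after as many further
rounds as there are labels between, unless an earlier one occupies the channel.

Synchronizers of length O(n log² n) exist by the probabilistic method (`card_failures`,
`exists_choice`, `exists_of_small`): each process transmits in each round of its schedule with
probability 1/(2n). Among about log n intervals there is one over which the number of awake
processes at most doubles, and in that interval the failure probability is exponentially small in
the number of processes involved, which beats the number of wake-up patterns. -/

namespace MutexMAC

/-! ### Channel feedback -/

section Channel

variable {M : Type} {n : ℕ} {tx : Fin n → Option (Signal M)}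

theorem channel_eq_silence (h : ∀ p, tx p = none) : channel tx = .silence := by
  have : (List.finRange n).filterMap tx = [] := by
    simp [h]
  simp [channel, this]

theorem channel_ne_silence {p : Fin n} {s : Signal M} (h : tx p = some s) :
    channel tx ≠ .silence := by
  have hmem : s ∈ (List.finRange n).filterMap tx :=
    List.mem_filterMap.2 ⟨p, List.mem_finRange p, h⟩
  unfold channel
  split
  · rename_i h0; simp [h0] at hmem
  · simp
  · simp

theorem channel_eq_message {p : Fin n} {s : Signal M} (h : tx p = some s)
    (hu : ∀ q, q ≠ p → tx q = none) : channel tx = .message s := by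
  obtain ⟨l₁, l₂, hl⟩ := List.append_of_mem (List.mem_finRange p)
  have hn := List.nodup_finRange n
  rw [hl, List.nodup_append] at hn
  obtain ⟨-, h2, h3⟩ := hn
  rw [List.nodup_cons] at h2
  have e1 : l₁.filterMap tx = [] := by
    rw [List.filterMap_eq_nil_iff]
    intro q hq
    exact hu q (h3 q hq p (by simp))
  have e2 : l₂.filterMap tx = [] := by
    rw [List.filterMap_eq_nil_iff]
    intro q hq
    exact hu q (fun e => h2.1 (e ▸ hq))
  have : (List.finRange n).filterMap tx = [s] := by
    rw [hl, List.filterMap_append, e1, List.filterMap_cons, h, e2]; rfl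
  simp [channel, this]

theorem exists_of_channel_eq_message {s : Signal M} (h : channel tx = .message s) :
    ∃ p, tx p = some s ∧ ∀ q, q ≠ p → tx q = none := by
  have h1 : (List.finRange n).filterMap tx = [s] := by
    unfold channel at h
    split at h
    · cases h
    · rename_i s' hs; cases h; exact hs
    · cases h
  obtain ⟨l₁, a, l₂, hl, h2, h3, h4⟩ := List.filterMap_eq_cons_iff.1 h1
  rw [List.filterMap_eq_nil_iff] at h4
  refine ⟨a, h3, fun q hq => ?_⟩
  have hm := List.mem_finRange q
  rw [hl] at hm
  simp only [List.mem_append, List.mem_cons] at hm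
  rcases hm with hm | hm | hm
  · exact h2 q hm
  · exact absurd hm hq
  · exact h4 q hm

/-- This makes an unsuccessful wake-up round sound the same whether nobody or several transmit, so
the silence counters of all listeners keep running through collisions. -/
theorem perceive_false_eq_silence (h : ¬ ∃ p, (tx p).isSome ∧ ∀ q, q ≠ p → tx q = none) :
    perceive false (channel tx) = .silence := by
  cases hc : channel tx with
  | silence => rfl
  | collision => rfl
  | message s =>
    obtain ⟨p, hp, hq⟩ := exists_of_channel_eq_message hc
    exact absurd ⟨p, by simp [hp], hq⟩ h

theorem reception_of_eq_none {cd : Bool} {p : Fin n} (h : tx p = none) :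
    reception cd tx p = some (perceive cd (channel tx)) := by
  simp [reception, h]

theorem reception_of_eq_some {cd : Bool} {p : Fin n} {s : Signal M} (h : tx p = some s) :
    reception cd tx p = none := by
  simp [reception, h]

theorem perceive_true (f : Feedback M) : perceive true f = f := by
  cases f <;> rfl

end Channel

/-! ### Transitions of one process, and the criterion for correctness -/

/-- The number of rounds that a process in its critical section still spends there. -/
def remainingCritical {S : Type} (σ : Stream'.Seq (ℕ+ × ℕ+)) (c : Config S) : ℕ :=
  match σ.get? c.cycle with
  | none => 0
  | some d => (d.2 : ℕ) - c.elapsed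

section Advance

variable {A : Algorithm} {σ : Stream'.Seq (ℕ+ × ℕ+)} {r : Option (Feedback A.Msg)}
  {c : Config A.State}

theorem advance_remainder (h : c.sec = .remainder) :
    (advance A σ r c).state = c.state ∧
      ((advance A σ r c).sec = .remainder ∨ (advance A σ r c).sec = .entry) := by
  unfold advance
  rw [h]
  dsimp only
  split
  · exact ⟨rfl, Or.inl rfl⟩
  · split
    · exact ⟨rfl, Or.inl rfl⟩
    · exact ⟨rfl, Or.inr rfl⟩

theorem advance_critical (h : c.sec = .critical) :
    (advance A σ r c).state = c.state ∧
      (((advance A σ r c).sec = .critical ∧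
        remainingCritical σ (advance A σ r c) < remainingCritical σ c) ∨
        (advance A σ r c).sec = .exit) := by
  unfold advance
  rw [h]
  dsimp only
  split
  · exact ⟨rfl, Or.inr rfl⟩
  · rename_i d hd
    split
    · refine ⟨rfl, Or.inl ⟨rfl, ?_⟩⟩
      simp only [remainingCritical, hd]
      omega
    · exact ⟨rfl, Or.inr rfl⟩

theorem advance_exit (h : c.sec = .exit) (he : (A.exitStep c.state r).2 = true) :
    (advance A σ r c).state = (A.exitStep c.state r).1 ∧
      (advance A σ r c).sec = .remainder := by
  unfold advance
  rw [h]
  simp [he]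

theorem advance_entry (h : c.sec = .entry) :
    (advance A σ r c).state = (A.entryStep c.state r).1 ∧
      (advance A σ r c).sec = if (A.entryStep c.state r).2 then .critical else .entry := by
  unfold advance
  rw [h]
  dsimp only
  split
  · exact ⟨rfl, rfl⟩
  · exact ⟨rfl, rfl⟩

end Advance

/-- A criterion for correctness: an invariant indexed by phases, a rank of phases that drops in
every waiting round, and a lexicographic rank that drops as long as a given process stays in the
entry section. -/
theorem correct_of_phases {A : Algorithm} {cd : Bool} {n : ℕ} {Φ : Type}
    (Inv : Φ → (Fin n → Config A.State) → Prop) (rank : Φ → ℕ)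
    (major minor : Strategy n → Φ → (Fin n → Config A.State) → Fin n → ℕ) (B : ℕ)
    (hexit : ∀ s r, (A.exitStep s r).2 = true) (hrank : ∀ φ, rank φ ≤ B) (φ₀ : Φ)
    (hinit : Inv φ₀ fun p => { sec := .remainder, state := A.init p, cycle := 0, elapsed := 0 })
    (hexcl : ∀ φ c p q, Inv φ c → (c p).sec = .critical → (c q).sec = .critical → p = q)
    (hstep : ∀ σ φ c, Inv φ c → ∃ φ', Inv φ' (step A cd σ c) ∧
      ((∃ p, (c p).sec = .entry) → (∀ p, (c p).sec ≠ .critical) → rank φ' < rank φ) ∧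
      ∀ p, (c p).sec = .entry → (step A cd σ c p).sec = .critical ∨
        major σ φ' (step A cd σ c) p < major σ φ c p ∨
        (major σ φ' (step A cd σ c) p ≤ major σ φ c p ∧
          minor σ φ' (step A cd σ c) p < minor σ φ c p)) :
    IsMutex A cd n ∧ IsFair A cd n ∧ makespan A cd n ≤ B := by
  have hinv : ∀ (σ : Strategy n) (t : ℕ), ∃ φ, Inv φ (run A cd σ t) := by
    intro σ t
    induction t with
    | zero => exact ⟨φ₀, hinit⟩
    | succ t ih =>
      obtain ⟨φ, hφ⟩ := ih
      obtain ⟨φ', h, -⟩ := hstep σ φ _ hφ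
      exact ⟨φ', h⟩
  have hfair : IsFair A cd n := by
    intro σ t p hp
    obtain ⟨φ, hφ⟩ := hinv σ t
    -- Nested strong induction on the pair (major, minor): a drop of the major part uses the outer
    -- hypothesis, whatever happens to the minor part.
    have key : ∀ a b t φ, Inv φ (run A cd σ t) → secAt A cd σ t p = .entry →
        major σ φ (run A cd σ t) p = a → minor σ φ (run A cd σ t) p = b →
        ∃ t' ≥ t, EntersCritical A cd σ t' p := by
      intro a
      induction a using Nat.strong_induction_on with
      | _ a iha =>
        intro b
        induction b using Nat.strong_induction_on with
        | _ b ihb =>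
          intro t φ hφ hp ha hb
          obtain ⟨φ', h', -, hr⟩ := hstep σ φ _ hφ
          by_cases hc : secAt A cd σ (t + 1) p = .critical
          · exact ⟨t, le_rfl, hp, hc⟩
          have hent : secAt A cd σ (t + 1) p = .entry := by
            have := (advance_entry (σ := σ p) (r := reception cd
              (fun q => transmission A (run A cd σ t q)) p) hp).2
            change secAt A cd σ (t + 1) p = _ at this
            split_ifs at this with h
            · exact absurd this hc
            · exact this
          have hr' := hr p hp
          rcases hr' with hr' | hr' | ⟨h1, h2⟩
          · exact absurd hr' hc
          · obtain ⟨t', ht', h⟩ := iha _ (ha ▸ hr') _ (t + 1) φ' h' hent rfl rfl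
            exact ⟨t', by omega, h⟩
          · rcases h1.lt_or_eq with h1 | h1
            · obtain ⟨t', ht', h⟩ := iha _ (ha ▸ h1) _ (t + 1) φ' h' hent rfl rfl
              exact ⟨t', by omega, h⟩
            · obtain ⟨t', ht', h⟩ := ihb _ (hb ▸ h2) (t + 1) φ' h' hent (h1.trans ha) rfl
              exact ⟨t', by omega, h⟩
    exact key _ _ t φ hφ hp rfl rfl
  refine ⟨fun σ => ⟨?_, ?_, ?_⟩, hfair, ?_⟩
  · intro t p q hp hq
    obtain ⟨φ, hφ⟩ := hinv σ t
    exact hexcl φ _ p q hφ hp hq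
  · intro t p hp
    exact ⟨t + 1, by omega, (advance_exit (σ := σ p) hp (hexit _ _)).2⟩
  · intro t p hp
    obtain ⟨t', ht, h⟩ := hfair σ t p hp
    exact ⟨t', ht, p, h⟩
  · refine iSup_le fun σ => iSup_le fun a => iSup_le fun l => iSup_le fun h => ?_
    -- Each round of a waiting interval costs at least one unit of rank, so the rank at its start
    -- bounds its length.
    have key : ∀ (l a : ℕ) φ, Inv φ (run A cd σ a) →
        (∀ t, a ≤ t → t < a + l → Waiting A cd σ t) → l ≤ rank φ := by
      intro l
      induction l with
      | zero => intros; exact Nat.zero_le _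
      | succ l ih =>
        intro a φ hφ hw
        obtain ⟨φ', h', hr, -⟩ := hstep σ φ _ hφ
        have h0 := hw a le_rfl (by omega)
        have h1 := hr h0.1 h0.2
        have h2 := ih (a + 1) φ' h' (fun t h1 h2 => hw t (by omega) (by omega))
        omega
    obtain ⟨φ, hφ⟩ := hinv σ a
    exact_mod_cast (key l a φ hφ h).trans (hrank φ)

/-! ### The election algorithm, for the channel with collision detection -/

/-- The modes of a process in the entry section of the election algorithm: waiting (having heard
silence in the previous round or not), having lost an election, or being a candidate that has
played a given number of rounds of the current election. -/
inductive ElectMode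
  | wait (b : Bool)
  | lost
  | cand (k : ℕ)

/-- The algorithm for the channel with collision detection. After two silent rounds the waiting
processes become candidates of an election, in which a candidate transmits in the rounds given by
its code word and drops out when it hears another one. The loser restarts the election when it hears
the message transmitted in the exit section. -/
abbrev electAlg (code : ℕ → ℕ → Bool) (len : ℕ → ℕ) : Algorithm where
  Msg := Bool
  State := ℕ × ElectMode
  init p := (p, .wait false)
  entryAction s := match s.2 with
    | .cand k => if code s.1 k then .transmit false else .listen
    | _ => .listen
  entryStep s r := match s.2, r with
    | .wait false, some .silence => ((s.1, .wait true), false)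
    | .wait true, some .silence => ((s.1, .cand 0), false)
    | .wait _, _ => ((s.1, .wait false), false)
    | .lost, some (.message (.regular true)) => ((s.1, .cand 0), false)
    | .lost, _ => ((s.1, .lost), false)
    | .cand k, none => ((s.1, .cand (k + 1)), decide (k + 1 = len s.1))
    | .cand k, some .silence => ((s.1, .cand (k + 1)), decide (k + 1 = len s.1))
    | .cand _, some _ => ((s.1, .lost), false)
  exitAction _ := .transmit true
  exitStep s _ := ((s.1, .wait false), true)

namespace Elect

/-- The section of a process together with its mode if it is in the entry section. -/
inductive View
  | rem
  | wait (b : Bool)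
  | lost
  | cand (k : ℕ)
  | crit
  | exit

def view (c : Config (ℕ × ElectMode)) : View :=
  match c.sec with
  | .remainder => .rem
  | .critical => .crit
  | .exit => .exit
  | .entry => match c.state.2 with
    | .wait b => .wait b
    | .lost => .lost
    | .cand k => .cand k

/-- The state carries the label `p`, and is the initial one in the remainder section. -/
def Good (p : ℕ) (c : Config (ℕ × ElectMode)) : Prop :=
  c.state.1 = p ∧ (c.sec = .remainder → c.state.2 = .wait false)

theorem sec_critical_iff {c : Config (ℕ × ElectMode)} : c.sec = .critical ↔ view c = .crit := by
  rcases c with ⟨s, ⟨l, m⟩, cy, e⟩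
  cases s <;> cases m <;> simp [view]

theorem sec_entry_iff {c : Config (ℕ × ElectMode)} : c.sec = .entry ↔
    (∃ b, view c = .wait b) ∨ view c = .lost ∨ ∃ k, view c = .cand k := by
  rcases c with ⟨s, ⟨l, m⟩, cy, e⟩
  cases s <;> cases m <;> simp [view]

section Local

variable {code : ℕ → ℕ → Bool} {len : ℕ → ℕ} {σ : Stream'.Seq (ℕ+ × ℕ+)}
  {r : Option (Feedback Bool)} {c : Config (ℕ × ElectMode)} {p : ℕ}

local notation "adv" => advance (electAlg code len)
local notation "tr" => transmission (electAlg code len)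

theorem good_advance (h : Good p c) : Good p (adv σ r c) := by
  rcases hs : c.sec
  · obtain ⟨h1, h2⟩ := advance_remainder (A := electAlg code len) (σ := σ) (r := r) hs
    exact ⟨by rw [h1]; exact h.1, fun _ => by rw [h1]; exact h.2 hs⟩
  · obtain ⟨h1, h2⟩ := advance_entry (A := electAlg code len) (σ := σ) (r := r) hs
    refine ⟨?_, fun h3 => ?_⟩
    · rw [h1]
      have := h.1
      simp only [electAlg]
      split <;> exact this
    · rw [h3] at h2
      split_ifs at h2
  · obtain ⟨h1, h2⟩ := advance_critical (A := electAlg code len) (σ := σ) (r := r) hs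
    refine ⟨by rw [h1]; exact h.1, fun h3 => ?_⟩
    rw [h3] at h2
    rcases h2 with ⟨h2, -⟩ | h2 <;> cases h2
  · obtain ⟨h1, h2⟩ := advance_exit (A := electAlg code len) (σ := σ) (r := r) hs rfl
    exact ⟨by rw [h1]; exact h.1, fun _ => by rw [h1]⟩

theorem view_of_rem (h : Good p c) (hv : view c = .rem) :
    view (adv σ r c) = .rem ∨ view (adv σ r c) = .wait false := by
  have hs : c.sec = .remainder := by
    rcases c with ⟨s, ⟨l, m⟩, cy, e⟩
    cases s <;> cases m <;> simp_all [view]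
  obtain ⟨h1, h2⟩ := advance_remainder (A := electAlg code len) (σ := σ) (r := r) hs
  have h3 := h.2 hs
  rcases h2 with h2 | h2
  · left; simp [view, h2]
  · right; simp [view, h2, h1, h3]

theorem view_of_exit (hv : view c = .exit) : view (adv σ r c) = .rem := by
  have hs : c.sec = .exit := by
    rcases c with ⟨s, ⟨l, m⟩, cy, e⟩
    cases s <;> cases m <;> simp_all [view]
  obtain ⟨h1, h2⟩ := advance_exit (A := electAlg code len) (σ := σ) (r := r) hs rfl
  simp [view, h2]

theorem view_of_crit (hv : view c = .crit) :
    (view (adv σ r c) = .crit ∧ remainingCritical σ (adv σ r c) < remainingCritical σ c) ∨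
      view (adv σ r c) = .exit := by
  obtain ⟨h1, h2⟩ := advance_critical (A := electAlg code len) (σ := σ) (r := r)
    (sec_critical_iff.2 hv)
  rcases h2 with ⟨h2, h3⟩ | h2
  · exact Or.inl ⟨sec_critical_iff.1 h2, h3⟩
  · right; simp [view, h2]

theorem sec_mode_of_wait {b : Bool} (hv : view c = .wait b) :
    c.sec = .entry ∧ c.state.2 = .wait b := by
  rcases c with ⟨s, ⟨l, m⟩, cy, e⟩
  cases s <;> cases m <;> simp_all [view]

theorem sec_mode_of_lost (hv : view c = .lost) : c.sec = .entry ∧ c.state.2 = .lost := by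
  rcases c with ⟨s, ⟨l, m⟩, cy, e⟩
  cases s <;> cases m <;> simp_all [view]

theorem sec_mode_of_cand {k : ℕ} (hv : view c = .cand k) :
    c.sec = .entry ∧ c.state.2 = .cand k := by
  rcases c with ⟨s, ⟨l, m⟩, cy, e⟩
  cases s <;> cases m <;> simp_all [view]

theorem view_of_wait_silence {b : Bool} (hv : view c = .wait b) (hr : r = some .silence) :
    view (adv σ r c) = if b then .cand 0 else .wait true := by
  obtain ⟨hs, hm⟩ := sec_mode_of_wait hv
  obtain ⟨h1, h2⟩ := advance_entry (A := electAlg code len) (σ := σ) (r := r) hs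
  cases b <;> simp_all [view, electAlg]

theorem view_of_wait {b : Bool} {f : Feedback Bool} (hv : view c = .wait b) (hr : r = some f)
    (hf : f ≠ .silence) : view (adv σ r c) = .wait false := by
  obtain ⟨hs, hm⟩ := sec_mode_of_wait hv
  obtain ⟨h1, h2⟩ := advance_entry (A := electAlg code len) (σ := σ) (r := r) hs
  cases b <;> cases f <;> simp_all [view, electAlg]

theorem view_of_lost_exit (hv : view c = .lost) (hr : r = some (.message (.regular true))) :
    view (adv σ r c) = .cand 0 := by
  obtain ⟨hs, hm⟩ := sec_mode_of_lost hv
  obtain ⟨h1, h2⟩ := advance_entry (A := electAlg code len) (σ := σ) (r := r) hs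
  simp_all [view, electAlg]

theorem view_of_lost (hv : view c = .lost) (hr : r ≠ some (.message (.regular true))) :
    view (adv σ r c) = .lost := by
  obtain ⟨hs, hm⟩ := sec_mode_of_lost hv
  obtain ⟨h1, h2⟩ := advance_entry (A := electAlg code len) (σ := σ) (r := r) hs
  rcases r with _ | f
  · simp_all [view, electAlg]
  · rcases f with _ | s | _
    · simp_all [view, electAlg]
    · rcases s with _ | m
      · simp_all [view, electAlg]
      · cases m <;> simp_all [view, electAlg]
    · simp_all [view, electAlg]

theorem view_of_cand {k : ℕ} (hg : Good p c) (hv : view c = .cand k)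
    (hr : r = none ∨ r = some .silence) :
    view (adv σ r c) = if k + 1 = len p then .crit else .cand (k + 1) := by
  obtain ⟨hs, hm⟩ := sec_mode_of_cand hv
  obtain ⟨h1, h2⟩ := advance_entry (A := electAlg code len) (σ := σ) (r := r) hs
  have := hg.1
  split_ifs with h <;> rcases hr with rfl | rfl <;> simp_all [view, electAlg]

theorem view_of_cand_lost {k : ℕ} {f : Feedback Bool} (hv : view c = .cand k) (hr : r = some f)
    (hf : f ≠ .silence) : view (adv σ r c) = .lost := by
  obtain ⟨hs, hm⟩ := sec_mode_of_cand hv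
  obtain ⟨h1, h2⟩ := advance_entry (A := electAlg code len) (σ := σ) (r := r) hs
  cases f <;> simp_all [view, electAlg]

theorem tr_rem (hv : view c = .rem) : tr c = none := by
  rcases c with ⟨s, ⟨l, m⟩, cy, e⟩
  cases s <;> cases m <;> simp_all [view, transmission]

theorem tr_wait {b : Bool} (hv : view c = .wait b) : tr c = none := by
  obtain ⟨hs, hm⟩ := sec_mode_of_wait hv
  simp [transmission, hs, electAlg, hm]

theorem tr_lost (hv : view c = .lost) : tr c = none := by
  obtain ⟨hs, hm⟩ := sec_mode_of_lost hv
  simp [transmission, hs, electAlg, hm]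

theorem tr_cand {k : ℕ} (hg : Good p c) (hv : view c = .cand k) :
    tr c = if code p k then some (.regular false) else none := by
  obtain ⟨hs, hm⟩ := sec_mode_of_cand hv
  have := hg.1
  split_ifs with h <;> simp_all [transmission, electAlg]

theorem tr_crit (hv : view c = .crit) : tr c = some .critical := by
  have hs := sec_critical_iff.2 hv
  simp [transmission, hs]

theorem tr_exit (hv : view c = .exit) : tr c = some (.regular true) := by
  rcases c with ⟨s, ⟨l, m⟩, cy, e⟩
  cases s <;> cases m <;> simp_all [view, transmission, electAlg]

end Local

/-! ### Phases and progress measures of the election algorithm -/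

/-- The phases of an execution of the election algorithm. -/
inductive Phase (n : ℕ)
  | idle0
  | idle1
  | elect (k : ℕ)
  | crit (q : Fin n)
  | exit (q : Fin n)

variable {n : ℕ} {code : ℕ → ℕ → Bool} {len : ℕ → ℕ}

/-- The parity condition in `elect` says that a newcomer can have just heard silence only before an
even round, which is never silent. In `crit` the flag is arbitrary because the last election round
may have been silent; at least one critical round precedes `exit`, and its message has cleared the
flag. -/
def PhaseInv (code : ℕ → ℕ → Bool) (len : ℕ → ℕ) (φ : Phase n)
    (c : Fin n → Config (ℕ × ElectMode)) : Prop :=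
  match φ with
  | .idle0 => ∀ p, view (c p) = .rem ∨ view (c p) = .wait false
  | .idle1 => (∀ p, view (c p) = .rem ∨ ∃ b, view (c p) = .wait b) ∧ ∃ p, view (c p) = .wait true
  | .elect k => (∀ p, view (c p) = .rem ∨ (∃ b, view (c p) = .wait b ∧ (b = true → k % 2 = 0)) ∨
      view (c p) = .lost ∨ (view (c p) = .cand k ∧ k < len p)) ∧ (∃ p, view (c p) = .cand k) ∧
      ∀ p q, view (c p) = .cand k → view (c q) = .cand k → ∀ i < k, code p i = code q i
  | .crit q => view (c q) = .crit ∧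
      ∀ p, p ≠ q → view (c p) = .rem ∨ (∃ b, view (c p) = .wait b) ∨ view (c p) = .lost
  | .exit q => view (c q) = .exit ∧
      ∀ p, p ≠ q → view (c p) = .rem ∨ view (c p) = .wait false ∨ view (c p) = .lost

def Inv (code : ℕ → ℕ → Bool) (len : ℕ → ℕ) (φ : Phase n)
    (c : Fin n → Config (ℕ × ElectMode)) : Prop :=
  (∀ p : Fin n, Good p (c p)) ∧ PhaseInv code len φ c

/-- The processes in the entry section that take part in the current batch of elections. -/
def View.IsMember : View → Prop
  | .lost => True
  | .cand _ => True
  | _ => False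

open Classical in
/-- The current batch. -/
noncomputable def members (c : Fin n → Config (ℕ × ElectMode)) : Finset (Fin n) :=
  Finset.univ.filter fun p => (view (c p)).IsMember

theorem mem_members {c : Fin n → Config (ℕ × ElectMode)} {p : Fin n} :
    p ∈ members c ↔ (view (c p)).IsMember := by
  simp [members]

theorem card_members_le (c : Fin n → Config (ℕ × ElectMode)) : (members c).card ≤ n := by
  simpa using (members c).card_le_univ

/-- The value bounds the number of rounds left before somebody is critical, with `K` a bound on the
length of the code words; the longest route is `exit`, `idle0`, `idle1`, then a full election. -/
def rank (K : ℕ) : Phase n → ℕ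
  | .idle0 => K + 3
  | .idle1 => K + 2
  | .elect k => 1 + (K - k)
  | .crit _ => 0
  | .exit _ => K + 4

/-- For a batch member this is the size of the batch, which drops with each winner. Outsiders carry
an extra `n + 2`, so that the end of the batch (value `n + 1` in `idle0`) is progress for them. In
`idle1` a latecomer who will miss the coming election needs `2 * n + 3`, more than `n + 2` plus any
batch size. -/
noncomputable def major (φ : Phase n) (c : Fin n → Config (ℕ × ElectMode)) (p : Fin n) : ℕ :=
  match φ, view (c p) with
  | .idle0, _ => n + 1
  | .idle1, .wait false => 2 * n + 3
  | .idle1, _ => n + 1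
  | _, .wait _ => n + 2 + (members c).card
  | _, _ => (members c).card

/-- It decreases from `crit` through `exit` to the next election. It may jump up when an election is
won, since the batch then loses a member and `major` drops for everyone still waiting. -/
noncomputable def minor (K : ℕ) (σ : Strategy n) (φ : Phase n)
    (c : Fin n → Config (ℕ × ElectMode)) : ℕ :=
  match φ with
  | .idle0 => 1
  | .idle1 => 0
  | .elect k => K - k
  | .crit q => K + 2 + remainingCritical (σ q) (c q)
  | .exit _ => K + 1

/-- What has to be shown about one round that starts in phase `φ`. -/
def StepGoal (code : ℕ → ℕ → Bool) (len : ℕ → ℕ) (K : ℕ) (σ : Strategy n) (φ : Phase n)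
    (c : Fin n → Config (ℕ × ElectMode)) : Prop :=
  ∃ φ', PhaseInv code len φ' (step (electAlg code len) true σ c) ∧
    ((∃ p, (c p).sec = .entry) → (∀ p, (c p).sec ≠ .critical) → rank K φ' < rank K φ) ∧
    ∀ p, (c p).sec = .entry → (step (electAlg code len) true σ c p).sec = .critical ∨
      major φ' (step (electAlg code len) true σ c) p < major φ c p ∨
      (major φ' (step (electAlg code len) true σ c) p ≤ major φ c p ∧
        minor K σ φ' (step (electAlg code len) true σ c) < minor K σ φ c)

section Step

variable {σ : Strategy n} {c : Fin n → Config (ℕ × ElectMode)} {K : ℕ}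

local notation "stp" => step (electAlg code len) true σ c
local notation "trs" => fun q => transmission (electAlg code len) (c q)

theorem reception_listen {p : Fin n} (h : transmission (electAlg code len) (c p) = none) :
    reception true (trs) p = some (channel (trs)) := by
  rw [reception_of_eq_none h, perceive_true]

theorem stepGoal_idle0 (hg : ∀ p : Fin n, Good p (c p)) (h : PhaseInv code len .idle0 c) :
    StepGoal code len K σ .idle0 c := by
  have htr : ∀ p, transmission (electAlg code len) (c p) = none := fun p =>
    (h p).elim tr_rem tr_wait
  have hr : ∀ p, reception true (trs) p = some .silence := fun p => by
    rw [reception_listen (htr p), channel_eq_silence htr]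
  have hw : ∀ p, view (c p) = .wait false → view (stp p) = .wait true := fun p hp => by
    exact view_of_wait_silence (code := code) (len := len) (σ := σ p) hp (hr p)
  have hrem : ∀ p, view (c p) = .rem → view (stp p) = .rem ∨ view (stp p) = .wait false :=
    fun p hp => view_of_rem (hg p) hp
  by_cases he : ∃ p, view (c p) = .wait false
  · refine ⟨.idle1, ⟨fun p => ?_, he.imp hw⟩, fun _ _ => by simp [rank], fun p hp => ?_⟩
    · rcases h p with hp | hp
      · exact (hrem p hp).imp id fun h => ⟨_, h⟩
      · exact Or.inr ⟨_, hw p hp⟩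
    · have hv : view (c p) = .wait false := by
        rcases h p with hp' | hp'
        · rw [sec_entry_iff, hp'] at hp; simp at hp
        · exact hp'
      right; right
      simp [major, hw p hv, minor]
  · have hall : ∀ p, view (c p) = .rem := fun p => (h p).resolve_right fun h => he ⟨p, h⟩
    have hne : ∀ p, (c p).sec ≠ .entry := fun p hp => by
      rw [sec_entry_iff, hall p] at hp; simp at hp
    exact ⟨.idle0, fun p => hrem p (hall p), fun ⟨p, hp⟩ => absurd hp (hne p),
      fun p hp => absurd hp (hne p)⟩

theorem stepGoal_idle1 (hg : ∀ p : Fin n, Good p (c p)) (hlen : ∀ p, 0 < len p)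
    (h : PhaseInv code len .idle1 c) : StepGoal code len K σ .idle1 c := by
  obtain ⟨h, q, hq⟩ := h
  have htr : ∀ p, transmission (electAlg code len) (c p) = none := fun p =>
    (h p).elim tr_rem fun ⟨_, hb⟩ => tr_wait hb
  have hr : ∀ p, reception true (trs) p = some .silence := fun p => by
    rw [reception_listen (htr p), channel_eq_silence htr]
  have hw : ∀ p b, view (c p) = .wait b →
      view (stp p) = if b then .cand 0 else .wait true := fun p b hp =>
    view_of_wait_silence hp (hr p)
  have hrem : ∀ p, view (c p) = .rem → view (stp p) = .rem ∨ view (stp p) = .wait false :=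
    fun p hp => view_of_rem (hg p) hp
  have hcard := card_members_le (stp)
  refine ⟨.elect 0, ⟨fun p => ?_, ⟨q, by simpa using hw q _ hq⟩, fun _ _ _ _ i hi => by omega⟩,
    fun _ _ => by simp only [rank]; omega, fun p hp => ?_⟩
  · rcases h p with hp | ⟨b, hp⟩
    · rcases hrem p hp with h1 | h1 <;> simp [h1]
    · have := hw p b hp
      cases b <;> simp_all
  · right; left
    rcases h p with hp' | ⟨b, hp'⟩
    · rw [sec_entry_iff, hp'] at hp; simp at hp
    · have := hw p b hp'
      cases b
      · simp [major, this, hp']; omega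
      · simp [major, this, hp']; omega

/-- No newcomer joins the batch in a round that every waiting process hears as non-silent; this
serves the critical and exit rounds. -/
theorem members_subset_of_listen {f : Feedback Bool} (hg : ∀ p : Fin n, Good p (c p))
    (hf : f ≠ .silence) (hc : ∀ p, view (c p) = .rem ∨ (∃ b, view (c p) = .wait b) ∨
      view (c p) = .lost ∨ view (c p) = .crit ∨ view (c p) = .exit)
    (hr : ∀ p b, view (c p) = .wait b → reception true (trs) p = some f) :
    members (stp) ⊆ members c := by
  intro p hp
  rw [mem_members] at hp ⊢
  rcases hc p with h | ⟨b, h⟩ | h | h | h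
  · have := view_of_rem (code := code) (len := len) (σ := σ p)
      (r := reception true (trs) p) (hg p) h
    change view (stp p) = _ ∨ view (stp p) = _ at this
    rcases this with h | h <;> simp [h, View.IsMember] at hp
  · have : view (stp p) = _ := view_of_wait (code := code) (len := len) (σ := σ p) h (hr p b h) hf
    simp [this, View.IsMember] at hp
  · simp [h, View.IsMember]
  · have := view_of_crit (code := code) (len := len) (σ := σ p) (r := reception true (trs) p) h
    change (view (stp p) = _ ∧ _) ∨ view (stp p) = _ at this
    rcases this with ⟨h, -⟩ | h <;> simp [h, View.IsMember] at hp
  · have : view (stp p) = _ :=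
      view_of_exit (code := code) (len := len) (σ := σ p) (r := reception true (trs) p) h
    simp [this, View.IsMember] at hp

theorem stepGoal_crit (hg : ∀ p : Fin n, Good p (c p)) {q : Fin n}
    (h : PhaseInv code len (.crit q) c) : StepGoal code len K σ (.crit q) c := by
  obtain ⟨hq, h⟩ := h
  have htr : ∀ p, p ≠ q → transmission (electAlg code len) (c p) = none := fun p hp => by
    rcases h p hp with h | ⟨b, h⟩ | h
    exacts [tr_rem h, tr_wait h, tr_lost h]
  have hch : channel (trs) = .message .critical := channel_eq_message (tr_crit hq) htr
  have hr : ∀ p, p ≠ q → reception true (trs) p = some (.message .critical) := fun p hp => by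
    rw [reception_listen (htr p hp), hch]
  have hw : ∀ p b, p ≠ q → view (c p) = .wait b → view (stp p) = .wait false :=
    fun p b hne hp => view_of_wait hp (hr p hne) (by simp)
  have hl : ∀ p, p ≠ q → view (c p) = .lost → view (stp p) = .lost :=
    fun p hne hp => view_of_lost hp (by rw [hr p hne]; simp)
  have hrem : ∀ p, view (c p) = .rem → view (stp p) = .rem ∨ view (stp p) = .wait false :=
    fun p hp => view_of_rem (hg p) hp
  have hsub : members (stp) ⊆ members c := by
    refine members_subset_of_listen hg (f := .message .critical) (by simp) (fun p => ?_)
      fun p b hp => hr p ?_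
    · by_cases hp : p = q
      · subst hp; simp [hq]
      · rcases h p hp with h | h | h <;> simp [h]
    · rintro rfl; rw [hp] at hq; cases hq
  have hcard := Finset.card_le_card hsub
  have hoth : ∀ p, p ≠ q → view (stp p) = .rem ∨ view (stp p) = .wait false ∨
      view (stp p) = .lost := fun p hp => by
    rcases h p hp with h | ⟨b, h⟩ | h
    · rcases hrem p h with h | h <;> simp [h]
    · simp [hw p b hp h]
    · simp [hl p hp h]
  have hmaj : ∀ φ', φ' = .crit q ∨ φ' = .exit q → ∀ p, (c p).sec = .entry →
      major φ' (stp) p ≤ major (.crit q) c p := by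
    intro φ' hφ p hp
    have hpq : p ≠ q := by
      rintro rfl; rw [sec_entry_iff, hq] at hp; simp at hp
    rcases h p hpq with h | ⟨b, h⟩ | h
    · rw [sec_entry_iff, h] at hp; simp at hp
    · have := hw p b hpq h
      rcases hφ with rfl | rfl <;> simpa [major, h, this] using hcard
    · have := hl p hpq h
      rcases hφ with rfl | rfl <;> simpa [major, h, this] using hcard
  have hnc : ∀ {P : Prop}, (∃ p, (c p).sec = .entry) → (∀ p, (c p).sec ≠ .critical) → P :=
    fun _ h => absurd (sec_critical_iff.2 hq) (h q)
  have := view_of_crit (code := code) (len := len) (σ := σ q) (r := reception true (trs) q) hq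
  rcases this with ⟨h1, h2⟩ | h1
  · refine ⟨.crit q, ⟨h1, fun p hp => ?_⟩, hnc, fun p hp => ?_⟩
    · rcases hoth p hp with h | h | h <;> simp [h]
    · exact Or.inr (Or.inr ⟨hmaj _ (Or.inl rfl) p hp, Nat.add_lt_add_left h2 _⟩)
  · refine ⟨.exit q, ⟨h1, hoth⟩, hnc, fun p hp => ?_⟩
    exact Or.inr (Or.inr ⟨hmaj _ (Or.inr rfl) p hp, by simp only [minor]; omega⟩)

theorem stepGoal_exit (hg : ∀ p : Fin n, Good p (c p)) (hlen : ∀ p, 0 < len p) {q : Fin n}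
    (h : PhaseInv code len (.exit q) c) : StepGoal code len K σ (.exit q) c := by
  obtain ⟨hq, h⟩ := h
  have htr : ∀ p, p ≠ q → transmission (electAlg code len) (c p) = none := fun p hp => by
    rcases h p hp with h | h | h
    exacts [tr_rem h, tr_wait h, tr_lost h]
  have hch : channel (trs) = .message (.regular true) := channel_eq_message (tr_exit hq) htr
  have hr : ∀ p, p ≠ q → reception true (trs) p = some (.message (.regular true)) :=
    fun p hp => by rw [reception_listen (htr p hp), hch]
  have hw : ∀ p, p ≠ q → view (c p) = .wait false → view (stp p) = .wait false :=
    fun p hne hp => view_of_wait hp (hr p hne) (by simp)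
  have hl : ∀ p, p ≠ q → view (c p) = .lost → view (stp p) = .cand 0 :=
    fun p hne hp => view_of_lost_exit hp (hr p hne)
  have hrem : ∀ p, view (c p) = .rem → view (stp p) = .rem ∨ view (stp p) = .wait false :=
    fun p hp => view_of_rem (hg p) hp
  have hqv : view (stp q) = .rem := view_of_exit hq
  have hsub : members (stp) ⊆ members c := by
    refine members_subset_of_listen hg (f := .message (.regular true)) (by simp) (fun p => ?_)
      fun p b hp => hr p ?_
    · by_cases hp : p = q
      · subst hp; simp [hq]
      · rcases h p hp with h | h | h <;> simp [h]
    · rintro rfl; rw [hp] at hq; cases hq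
  have hcard := Finset.card_le_card hsub
  have hne : ∀ p, (c p).sec = .entry → p ≠ q := by
    rintro p hp rfl; rw [sec_entry_iff, hq] at hp; simp at hp
  by_cases hex : ∃ p, view (c p) = .lost
  · obtain ⟨p₀, hp₀⟩ := hex
    have hp₀q : p₀ ≠ q := by rintro rfl; rw [hp₀] at hq; cases hq
    refine ⟨.elect 0, ⟨fun p => ?_, ⟨p₀, hl p₀ hp₀q hp₀⟩, fun _ _ _ _ i hi => by omega⟩,
      fun _ _ => by simp only [rank]; omega, fun p hp => Or.inr (Or.inr ⟨?_, ?_⟩)⟩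
    · by_cases hpq : p = q
      · subst hpq; exact Or.inl hqv
      · rcases h p hpq with h | h | h
        · rcases hrem p h with h | h <;> simp [h]
        · simp [hw p hpq h]
        · simp [hl p hpq h, hlen]
    · have hpq := hne p hp
      rcases h p hpq with h | h | h
      · rw [sec_entry_iff, h] at hp; simp at hp
      · have := hw p hpq h
        simpa [major, h, this] using hcard
      · have := hl p hpq h
        simpa [major, h, this] using hcard
    · simp [minor]
  · have hall : ∀ p, p ≠ q → view (c p) = .rem ∨ view (c p) = .wait false := fun p hp =>
      (h p hp).imp id fun h => h.resolve_right fun h => hex ⟨p, h⟩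
    refine ⟨.idle0, fun p => ?_, fun _ _ => by simp [rank], fun p hp => Or.inr (Or.inl ?_)⟩
    · by_cases hpq : p = q
      · subst hpq; exact Or.inl hqv
      · exact (hall p hpq).elim (hrem p) fun h => Or.inr (hw p hpq h)
    · have hpq := hne p hp
      rcases hall p hpq with h | h
      · rw [sec_entry_iff, h] at hp; simp at hp
      · simp only [major, h]; omega

/-- One round of an election: for some bit `β`, the candidates whose code word has the bit `β`
survive, and the others lose. -/
theorem election_round (hg : ∀ p : Fin n, Good p (c p)) {k : ℕ}
    (heven : ∀ p i, i % 2 = 0 → code p i = true) (h : PhaseInv code len (.elect k) c) :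
    (∀ p, view (c p) = .rem → view (stp p) = .rem ∨ view (stp p) = .wait false) ∧
    (∀ p b, view (c p) = .wait b →
      ∃ b', view (stp p) = .wait b' ∧ (b' = true → (k + 1) % 2 = 0)) ∧
    (∀ p, view (c p) = .lost → view (stp p) = .lost) ∧
    ∃ β, (∃ p, view (c p) = .cand k ∧ code p k = β) ∧
      (∀ p, view (c p) = .cand k → code p k = β →
        view (stp p) = if k + 1 = len p then .crit else .cand (k + 1)) ∧
      ∀ p, view (c p) = .cand k → code p k ≠ β → view (stp p) = .lost := by
  obtain ⟨h, ⟨p₀, hp₀⟩, -⟩ := h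
  refine ⟨fun p hp => view_of_rem (hg p) hp, ?_⟩
  have htr : ∀ p, view (c p) = .rem ∨ (∃ b, view (c p) = .wait b) ∨ view (c p) = .lost →
      transmission (electAlg code len) (c p) = none := fun p hp => by
    rcases hp with h | ⟨b, h⟩ | h
    exacts [tr_rem h, tr_wait h, tr_lost h]
  have htc : ∀ p, view (c p) = .cand k → transmission (electAlg code len) (c p) =
      if code p k then some (.regular false) else none := fun p hp => tr_cand (hg p) hp
  have hmsg : ∀ p s, transmission (electAlg code len) (c p) = some s → s = .regular false := by
    intro p s hs
    rcases h p with h | ⟨b, h, -⟩ | h | ⟨h, -⟩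
    · rw [htr p (by simp [h])] at hs; cases hs
    · rw [htr p (by simp [h])] at hs; cases hs
    · rw [htr p (by simp [h])] at hs; cases hs
    · rw [htc p h] at hs
      split_ifs at hs
      cases hs; rfl
  have hlost : ∀ p, view (c p) = .lost → view (stp p) = .lost := fun p hp => by
    refine view_of_lost hp ?_
    rw [reception_listen (htr p (by simp [hp]))]
    intro he
    obtain ⟨q, hq, -⟩ := exists_of_channel_eq_message (Option.some.inj he)
    have := hmsg q _ hq
    cases this
  by_cases hT : ∃ q, view (c q) = .cand k ∧ code q k = true
  · have hne : channel (trs) ≠ .silence := by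
      obtain ⟨q, hq, hq'⟩ := hT
      have := htc q hq
      rw [if_pos hq'] at this
      exact channel_ne_silence (tx := trs) (p := q) this
    refine ⟨fun p b hp => ⟨false, ?_, by simp⟩, hlost, true, hT, fun p hp hb => ?_,
      fun p hp hb => ?_⟩
    · exact view_of_wait hp (reception_listen (htr p (by simp [hp]))) hne
    · have := htc p hp
      rw [if_pos hb] at this
      exact view_of_cand (hg p) hp (Or.inl (reception_of_eq_some this))
    · have := htc p hp
      rw [if_neg hb] at this
      exact view_of_cand_lost hp (reception_listen this) hne
  · have hf : ∀ p : Fin n, view (c p) = .cand k → code p k = false := fun p hp => by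
      by_contra hc
      exact hT ⟨p, hp, by simpa using hc⟩
    have hall : ∀ p, transmission (electAlg code len) (c p) = none := fun p => by
      rcases h p with h | ⟨b, h, -⟩ | h | ⟨h, -⟩
      · exact htr p (by simp [h])
      · exact htr p (by simp [h])
      · exact htr p (by simp [h])
      · rw [htc p h, if_neg (by simp [hf p h])]
    have hr : ∀ p, reception true (trs) p = some .silence := fun p => by
      rw [reception_listen (hall p), channel_eq_silence hall]
    -- Even positions of all words carry a 1, so a silent round is odd; a waiting process then has
    -- not heard silence in the preceding round and cannot become a candidate.
    have hodd : k % 2 ≠ 0 := fun hk => hT ⟨p₀, hp₀, heven _ _ hk⟩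
    refine ⟨fun p b hp => ⟨true, ?_, fun _ => by omega⟩, hlost, false, ⟨p₀, hp₀, hf p₀ hp₀⟩,
      fun p hp _ => view_of_cand (hg p) hp (Or.inr (hr p)),
      fun p hp hb => absurd (hf p hp) hb⟩
    have hb : b = false := by
      rcases h p with h | ⟨b', h, hb'⟩ | h | ⟨h, -⟩
      · rw [hp] at h; cases h
      · rw [hp] at h; cases h
        by_contra hb
        exact hodd (hb' (by simpa using hb))
      · rw [hp] at h; cases h
      · rw [hp] at h; cases h
    subst hb
    exact view_of_wait_silence (code := code) (len := len) (σ := σ p) hp (hr p)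

theorem stepGoal_elect (hg : ∀ p : Fin n, Good p (c p)) {k : ℕ}
    (heven : ∀ p i, i % 2 = 0 → code p i = true) (hK : ∀ p : Fin n, len p ≤ K)
    (hcode : ∀ p q : ℕ, p ≠ q → ∃ i, i < len p ∧ i < len q ∧ code p i ≠ code q i)
    (h : PhaseInv code len (.elect k) c) : StepGoal code len K σ (.elect k) c := by
  obtain ⟨hrem, hwait, hlost, β, ⟨q, hq, hqβ⟩, hsurv, hfail⟩ :=
    election_round (σ := σ) hg heven h
  obtain ⟨h, -, hagree⟩ := h
  have hkK : k < K := by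
    rcases h q with h | ⟨b, h, -⟩ | h | ⟨-, h⟩
    · rw [hq] at h; cases h
    · rw [hq] at h; cases h
    · rw [hq] at h; cases h
    · exact h.trans_le (hK q)
  have hsub : members (stp) ⊆ members c := by
    intro p hp
    rw [mem_members] at hp ⊢
    rcases h p with h | ⟨b, h, -⟩ | h | ⟨h, -⟩
    · rcases hrem p h with h | h <;> simp [h, View.IsMember] at hp
    · obtain ⟨b', h, -⟩ := hwait p b h
      simp [h, View.IsMember] at hp
    · simp [h, View.IsMember]
    · simp [h, View.IsMember]
  have hcard := Finset.card_le_card hsub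
  by_cases hw : ∃ p, view (c p) = .cand k ∧ code p k = β ∧ k + 1 = len p
  · obtain ⟨w, hwc, hwβ, hwl⟩ := hw
    have hwv : view (stp w) = .crit := by rw [hsurv w hwc hwβ, if_pos hwl]
    -- Another survivor would agree with the whole word of `w`, contradicting prefix-freeness.
    have huniq : ∀ p, view (c p) = .cand k → code p k = β → p = w := by
      intro p hp hpβ
      by_contra hne
      obtain ⟨i, -, hi2, hi3⟩ := hcode p w (fun e => hne (Fin.ext e))
      rcases Nat.lt_or_ge i k with hik | hik
      · exact hi3 (hagree p w hp hwc i hik)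
      · obtain rfl : i = k := by omega
        exact hi3 (hpβ.trans hwβ.symm)
    -- The winner leaves the batch and nobody joins it, which is the drop of `major` for all other
    -- processes.
    have hss : members (stp) ⊂ members c := by
      refine Finset.ssubset_iff_subset_ne.2 ⟨hsub, fun he => ?_⟩
      have hm : w ∈ members c := by simp [mem_members, hwc, View.IsMember]
      rw [← he, mem_members, hwv] at hm
      exact hm
    have hlt := Finset.card_lt_card hss
    refine ⟨.crit w, ⟨hwv, fun p hp => ?_⟩, fun _ _ => by simp only [rank]; omega,
      fun p hp => ?_⟩
    · rcases h p with h | ⟨b, h, -⟩ | h | ⟨h, -⟩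
      · rcases hrem p h with h | h <;> simp [h]
      · obtain ⟨b', h, -⟩ := hwait p b h
        simp [h]
      · simp [hlost p h]
      · by_cases hpβ : code p k = β
        · exact absurd (huniq p h hpβ) hp
        · simp [hfail p h hpβ]
    · by_cases hpw : p = w
      · left; rw [hpw]; exact sec_critical_iff.2 hwv
      right; left
      rcases h p with h | ⟨b, h, -⟩ | h | ⟨h, -⟩
      · rw [sec_entry_iff, h] at hp; simp at hp
      · obtain ⟨b', h', -⟩ := hwait p b h
        simpa [major, h, h'] using hlt
      · simpa [major, h, hlost p h] using hlt
      · by_cases hpβ : code p k = β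
        · exact absurd (huniq p h hpβ) hpw
        · simpa [major, h, hfail p h hpβ] using hlt
  · have hsurv' : ∀ p, view (c p) = .cand k → code p k = β → view (stp p) = .cand (k + 1) := by
      intro p hp hpβ
      rw [hsurv p hp hpβ, if_neg fun he => hw ⟨p, hp, hpβ, he⟩]
    have hback : ∀ p, view (stp p) = .cand (k + 1) → view (c p) = .cand k ∧ code p k = β := by
      intro p hp
      rcases h p with h | ⟨b, h, -⟩ | h | ⟨h, -⟩
      · rcases hrem p h with h | h <;> rw [hp] at h <;> cases h
      · obtain ⟨b', h', -⟩ := hwait p b h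
        rw [hp] at h'; cases h'
      · have := hlost p h
        rw [hp] at this; cases this
      · refine ⟨h, ?_⟩
        by_contra hpβ
        have := hfail p h hpβ
        rw [hp] at this; cases this
    refine ⟨.elect (k + 1), ⟨fun p => ?_, ⟨q, hsurv' q hq hqβ⟩, fun p p' hp hp' i hi => ?_⟩,
      fun _ _ => by simp only [rank]; omega, fun p hp => Or.inr (Or.inr ⟨?_, ?_⟩)⟩
    · rcases h p with h | ⟨b, h, -⟩ | h | ⟨h, hl⟩
      · rcases hrem p h with h | h <;> simp [h]
      · obtain ⟨b', h, hb⟩ := hwait p b h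
        exact Or.inr (Or.inl ⟨b', h, hb⟩)
      · simp [hlost p h]
      · by_cases hpβ : code p k = β
        · have hne : k + 1 ≠ len p := fun he => hw ⟨p, h, hpβ, he⟩
          exact Or.inr (Or.inr (Or.inr ⟨hsurv' p h hpβ, by omega⟩))
        · simp [hfail p h hpβ]
    · obtain ⟨h1, h2⟩ := hback p hp
      obtain ⟨h3, h4⟩ := hback p' hp'
      rcases Nat.lt_or_ge i k with hik | hik
      · exact hagree p p' h1 h3 i hik
      · obtain rfl : i = k := by omega
        exact h2.trans h4.symm
    · rcases h p with h | ⟨b, h, -⟩ | h | ⟨h, -⟩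
      · rw [sec_entry_iff, h] at hp; simp at hp
      · obtain ⟨b', h', -⟩ := hwait p b h
        simpa [major, h, h'] using hcard
      · simpa [major, h, hlost p h] using hcard
      · by_cases hpβ : code p k = β
        · simpa [major, h, hsurv' p h hpβ] using hcard
        · simpa [major, h, hfail p h hpβ] using hcard
    · simp only [minor]; omega

end Step

theorem correct (heven : ∀ p i, i % 2 = 0 → code p i = true) (hlen : ∀ p, 0 < len p)
    (hcode : ∀ p q : ℕ, p ≠ q → ∃ i, i < len p ∧ i < len q ∧ code p i ≠ code q i)
    (K : ℕ) (hK : ∀ p : Fin n, len p ≤ K) :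
    IsMutex (electAlg code len) true n ∧ IsFair (electAlg code len) true n ∧
      makespan (electAlg code len) true n ≤ (K + 4 : ℕ) := by
  refine correct_of_phases (Inv code len) (rank K) (fun _ φ c p => major φ c p)
    (fun σ φ c _ => minor K σ φ c) (K + 4) (fun _ _ => rfl) ?_ .idle0 ?_ ?_ ?_
  · intro φ
    cases φ <;> simp only [rank] <;> omega
  · exact ⟨fun p => ⟨rfl, fun _ => rfl⟩, fun p => Or.inl rfl⟩
  · intro φ c p q hφ hp hq
    replace hφ := hφ.2
    rw [sec_critical_iff] at hp hq
    have hcrit : ∀ q', φ = .crit q' → p = q := by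
      rintro q' rfl
      have : ∀ p, view (c p) = .crit → p = q' := fun p hp => by
        by_contra hne
        rcases hφ.2 p hne with h | ⟨b, h⟩ | h <;> rw [hp] at h <;> cases h
      rw [this p hp, this q hq]
    cases φ with
    | idle0 => rcases hφ p with h | h <;> rw [hp] at h <;> cases h
    | idle1 => rcases hφ.1 p with h | ⟨b, h⟩ <;> rw [hp] at h <;> cases h
    | elect k => rcases hφ.1 p with h | ⟨b, h, -⟩ | h | ⟨h, -⟩ <;> rw [hp] at h <;> cases h
    | crit q' => exact hcrit q' rfl
    | exit q' =>
      by_cases hne : p = q'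
      · subst hne
        rw [hφ.1] at hp; cases hp
      · rcases hφ.2 p hne with h | h | h <;> rw [hp] at h <;> cases h
  · intro σ φ c ⟨hg, hφ⟩
    have goal : StepGoal code len K σ φ c := by
      cases φ with
      | idle0 => exact stepGoal_idle0 hg hφ
      | idle1 => exact stepGoal_idle1 hg hlen hφ
      | elect k => exact stepGoal_elect hg heven hK hcode hφ
      | crit q => exact stepGoal_crit hg hφ
      | exit q => exact stepGoal_exit hg hlen hφ
    obtain ⟨φ', h1, h2, h3⟩ := goal
    exact ⟨φ', ⟨fun p => good_advance (hg p), h1⟩, h2, h3⟩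

/-! ### The prefix-free code -/

/-- A prefix-free code for the natural numbers with ones in all even positions. -/
def codeWord (p i : ℕ) : Bool :=
  if i % 2 = 0 then true
  else if i / 2 < p.size then true
  else if i / 2 = p.size then false
  else p.testBit (i / 2 - p.size - 1)

def codeLength (p : ℕ) : ℕ := 4 * p.size + 2

/-- The odd positions spell the size of the label in unary, a 0, and then its binary digits. Labels
of different sizes differ where the shorter unary part ends; labels of equal size differ at a binary
digit. -/
theorem codeWord_prefix_free {p q : ℕ} (hpq : p ≠ q) :
    ∃ i, i < codeLength p ∧ i < codeLength q ∧ codeWord p i ≠ codeWord q i := by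
  have aux : ∀ p q : ℕ, p.size < q.size →
      ∃ i, i < codeLength p ∧ i < codeLength q ∧ codeWord p i ≠ codeWord q i := by
    intro p q h
    refine ⟨2 * p.size + 1, by unfold codeLength; omega, by unfold codeLength; omega, ?_⟩
    have h1 : (2 * p.size + 1) % 2 ≠ 0 := by omega
    have h2 : (2 * p.size + 1) / 2 = p.size := by omega
    simp [codeWord, h2, h]
  rcases lt_trichotomy p.size q.size with h | h | h
  · exact aux p q h
  · obtain ⟨j, hj⟩ : ∃ j, p.testBit j ≠ q.testBit j := by
      by_contra hc
      push Not at hc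
      exact hpq (Nat.eq_of_testBit_eq hc)
    have hjs : j < p.size := by
      by_contra hjs
      have hle : p.size ≤ j := by omega
      have hp : p.testBit j = false := Nat.testBit_lt_two_pow (Nat.size_le.1 hle)
      have hq : q.testBit j = false := Nat.testBit_lt_two_pow (Nat.size_le.1 (h ▸ hle))
      exact hj (hp.trans hq.symm)
    refine ⟨2 * (p.size + 1 + j) + 1, by unfold codeLength; omega, by unfold codeLength; omega, ?_⟩
    have h1 : (2 * (p.size + 1 + j) + 1) % 2 ≠ 0 := by omega
    have h2 : (2 * (p.size + 1 + j) + 1) / 2 = p.size + 1 + j := by omega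
    have h3 : ¬ (p.size + 1 + j < p.size) := by omega
    have h4 : p.size + 1 + j ≠ p.size := by omega
    have h5 : p.size + 1 + j - p.size - 1 = j := by omega
    rw [h] at h2 h3 h4 h5
    simpa [codeWord, h1, h2, h3, h4, h5, h] using hj
  · obtain ⟨i, h1, h2, h3⟩ := aux q p h
    exact ⟨i, h2, h1, h3.symm⟩

theorem correct_codeWord (n : ℕ) :
    IsMutex (electAlg codeWord codeLength) true n ∧ IsFair (electAlg codeWord codeLength) true n ∧
      makespan (electAlg codeWord codeLength) true n ≤ (4 * n.size + 6 : ℕ) := by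
  refine correct (fun p i hi => by simp [codeWord, hi]) (fun p => by simp [codeLength])
    (fun p q => codeWord_prefix_free) (4 * n.size + 2) fun p => ?_
  have := Nat.size_le_size p.2.le
  unfold codeLength
  omega

end Elect

/-! ### Synchronizers by the probabilistic method -/

/-- The schedules `s p`, of length `m`, are such that, whenever some of the processes `0, …, n - 1`
start their schedules in arbitrary rounds, the first of them in round `0`, exactly one process
transmits in some round before round `m`. -/
def IsSynchronizer (n m : ℕ) (s : ℕ → ℕ → Bool) : Prop :=
  ∀ (X : Finset (Fin n)) (w : Fin n → ℕ), (∃ p ∈ X, w p = 0) → ∃ t < m, ∃ p ∈ X,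
    w p ≤ t ∧ s p (t - w p) = true ∧ ∀ q ∈ X, q ≠ p → w q ≤ t → s q (t - w q) = false

namespace Synchronizer

/-- Exactly one coordinate of `h` is zero, and it lies in `A`. -/
def Isolated {n N : ℕ} [NeZero N] (A : Finset (Fin n)) (h : Fin n → Fin N) : Prop :=
  ∃ p ∈ A, h p = 0 ∧ ∀ q, q ≠ p → h q ≠ 0

open Classical in
-- For each p in A there are `(N - 1) ^ (n - 1)` choices where p is the only zero, and these sets
-- are disjoint for distinct p.
theorem card_isolated {n N : ℕ} [NeZero N] (A : Finset (Fin n)) :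
    A.card * (N - 1) ^ (n - 1) ≤
      (Finset.univ.filter fun h : Fin n → Fin N => Isolated A h).card := by
  let S : Fin n → Finset (Fin n → Fin N) := fun p =>
    Fintype.piFinset fun q => if q = p then {0} else Finset.univ.erase 0
  have hS : ∀ p h, h ∈ S p ↔ h p = 0 ∧ ∀ q, q ≠ p → h q ≠ 0 := by
    intro p h
    simp only [S, Fintype.mem_piFinset]
    constructor
    · intro H
      refine ⟨by simpa using H p, fun q hq => by simpa [hq] using H q⟩
    · rintro ⟨h1, h2⟩ q
      by_cases hq : q = p
      · subst hq; simpa using h1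
      · simpa [hq] using h2 q hq
  have hcard : ∀ p, (S p).card = (N - 1) ^ (n - 1) := by
    intro p
    simp only [S, Fintype.card_piFinset]
    rw [← Finset.mul_prod_erase _ _ (Finset.mem_univ p)]
    have : ∀ q ∈ Finset.univ.erase p,
        (if q = p then ({0} : Finset (Fin N)) else Finset.univ.erase 0).card = N - 1 := by
      intro q hq
      rw [if_neg (Finset.ne_of_mem_erase hq), Finset.card_erase_of_mem (Finset.mem_univ _)]
      simp
    rw [Finset.prod_congr rfl this, Finset.prod_const,
      Finset.card_erase_of_mem (Finset.mem_univ _)]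
    simp
  have hdisj : (A : Set (Fin n)).PairwiseDisjoint S := by
    intro p _ q _ hpq
    refine Finset.disjoint_left.2 fun h hp hq => ?_
    exact ((hS q h).1 hq).2 p hpq ((hS p h).1 hp).1
  have : A.biUnion S ⊆ Finset.univ.filter fun h : Fin n → Fin N => Isolated A h := by
    intro h hh
    obtain ⟨p, hp, hh⟩ := Finset.mem_biUnion.1 hh
    simpa using ⟨p, hp, (hS p h).1 hh⟩
  calc A.card * (N - 1) ^ (n - 1) = (A.biUnion S).card := by
        rw [Finset.card_biUnion hdisj, Finset.sum_congr rfl fun p _ => hcard p]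
        simp
    _ ≤ _ := Finset.card_le_card this

open Classical in
-- In probabilistic terms: with N = 2n the chance of isolation is at least (|A|/N)(1 - 1/N)^(n-1) ≥
-- |A|/(4n), and 1 - u ≤ exp(-u). Processes outside A also draw a value, which costs only a constant
-- factor and keeps the sample space fixed.
theorem card_not_isolated {n N : ℕ} [NeZero N] (hn : 0 < n) (hN : N = 2 * n)
    (A : Finset (Fin n)) :
    ((Finset.univ.filter fun h : Fin n → Fin N => ¬ Isolated A h).card : ℝ) ≤
      (N : ℝ) ^ n * Real.exp (-(A.card / (4 * n))) := by
  have hn' : (0 : ℝ) < n := by exact_mod_cast hn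
  have hN' : (N : ℝ) = 2 * n := by exact_mod_cast hN
  have hN0 : (0 : ℝ) < N := by rw [hN']; positivity
  have h1 : ((Finset.univ.filter fun h : Fin n → Fin N => Isolated A h).card : ℝ) +
      (Finset.univ.filter fun h : Fin n → Fin N => ¬ Isolated A h).card = (N : ℝ) ^ n := by
    have := Finset.card_filter_add_card_filter_not (s := (Finset.univ : Finset (Fin n → Fin N)))
      (fun h => Isolated A h)
    rw [Finset.card_univ, Fintype.card_fun, Fintype.card_fin, Fintype.card_fin] at this
    exact_mod_cast this
  have h2 : (A.card : ℝ) * ((N : ℝ) - 1) ^ (n - 1) ≤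
      (Finset.univ.filter fun h : Fin n → Fin N => Isolated A h).card := by
    have := card_isolated (N := N) A
    have hc : ((N - 1 : ℕ) : ℝ) = (N : ℝ) - 1 := by
      rw [Nat.cast_sub (by omega)]; simp
    rw [← hc]
    exact_mod_cast this
  -- Bernoulli's inequality gives (1 - 1/N)^(n-1) ≥ 1 - (n-1)/(2n) ≥ 1/2.
  have h3 : (N : ℝ) ^ (n - 1) / 2 ≤ ((N : ℝ) - 1) ^ (n - 1) := by
    have hb : 1 + ((n - 1 : ℕ) : ℝ) * (-(1 / N)) ≤ (1 + -(1 / (N : ℝ))) ^ (n - 1) := by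
      apply one_add_mul_le_pow
      have : 1 / (N : ℝ) ≤ 1 := by
        rw [div_le_one hN0]
        exact_mod_cast (by omega : 1 ≤ N)
      linarith
    have hc : ((n - 1 : ℕ) : ℝ) = (n : ℝ) - 1 := by
      rw [Nat.cast_sub (by omega)]; simp
    have hhalf : (1 / 2 : ℝ) ≤ (1 + -(1 / (N : ℝ))) ^ (n - 1) := by
      refine le_trans ?_ hb
      rw [hc, hN']
      have : ((n : ℝ) - 1) * (1 / (2 * n)) ≤ 1 / 2 := by
        rw [mul_one_div, div_le_div_iff₀ (by positivity) (by norm_num)]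
        linarith
      linarith
    have he : (N : ℝ) - 1 = N * (1 + -(1 / (N : ℝ))) := by field_simp; ring
    rw [he, mul_pow]
    have : (0 : ℝ) ≤ (N : ℝ) ^ (n - 1) := by positivity
    nlinarith
  have h4 : (N : ℝ) ^ n * (A.card / (4 * n)) ≤
      (Finset.univ.filter fun h : Fin n → Fin N => Isolated A h).card := by
    refine le_trans ?_ h2
    calc (N : ℝ) ^ n * (A.card / (4 * n)) = A.card * ((N : ℝ) ^ (n - 1) / 2) := by
          obtain ⟨k, rfl⟩ : ∃ k, n = k + 1 := ⟨n - 1, by omega⟩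
          rw [Nat.add_sub_cancel, pow_succ, hN']
          field_simp
          ring
      _ ≤ _ := mul_le_mul_of_nonneg_left h3 (Nat.cast_nonneg _)
  have h5 := Real.add_one_le_exp (-((A.card : ℝ) / (4 * n)))
  have h6 : (0 : ℝ) < (N : ℝ) ^ n := by positivity
  nlinarith

variable {n m N : ℕ}

/-- The processes awake in round `t`, for the wake-up rounds `w`. -/
def awake (w : Fin n → Option (Fin m)) (t : ℕ) : Finset (Fin n) :=
  Finset.univ.filter fun p => ∃ v, w p = some v ∧ (v : ℕ) ≤ t

/-- The processes that ever wake up. -/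
def support (w : Fin n → Option (Fin m)) : Finset (Fin n) :=
  Finset.univ.filter fun p => (w p).isSome

/-- What the random choices `f` yield in round `t`. -/
def shifted [NeZero m] (w : Fin n → Option (Fin m)) (f : Fin n → Fin m → Fin N) (t : Fin m)
    (p : Fin n) : Fin N :=
  f p (t - (w p).getD 0)

open Classical in
/-- The choices without a success in the `j`-th interval of length `L`. -/
noncomputable def failures [NeZero m] [NeZero N] (L j : ℕ) (w : Fin n → Option (Fin m)) :
    Finset (Fin n → Fin m → Fin N) :=
  Finset.univ.filter fun f => ∀ t : Fin m, j * L ≤ t → (t : ℕ) < (j + 1) * L →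
    ¬ Isolated (awake w t) (shifted w f t)

open Classical in
-- For a fixed wake-up pattern the rounds of the interval are independent, and in each at least half
-- of the support is awake. So each round fails with probability at most exp(-|support|/(8n)), and
-- the `L` rounds multiply.
theorem card_failures [NeZero m] [NeZero N] (hn : 0 < n) (hN : N = 2 * n) {L j : ℕ}
    (hm : (j + 1) * L ≤ m) (w : Fin n → Option (Fin m))
    (hw : (support w).card ≤ 2 * (awake w (j * L)).card) :
    ((failures (N := N) L j w).card : ℝ) ≤
      ((N : ℝ) ^ n) ^ m * Real.exp (-(L / (8 * n))) ^ (support w).card := by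
  have hn' : (0 : ℝ) < n := by exact_mod_cast hn
  let B : Fin m → Finset (Fin n → Fin N) := fun t =>
    if j * L ≤ t ∧ (t : ℕ) < (j + 1) * L then
      Finset.univ.filter fun h => ¬ Isolated (awake w t) h
    else Finset.univ
  have h1 : (failures (N := N) L j w).card ≤ (Fintype.piFinset B).card := by
    -- Shifting each process's choices cyclically by its wake-up round is injective. This is the
    -- independence of rounds: the constraints on shifted choices form a product over rounds.
    refine Finset.card_le_card_of_injOn (shifted w) (fun f hf => ?_) fun f _ g _ hfg => ?_
    · simp only [failures, Finset.coe_filter, Finset.mem_univ, true_and, Set.mem_ofPred_eq] at hf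
      simp only [Finset.mem_coe, Fintype.mem_piFinset]
      intro t
      by_cases ht : j * L ≤ t ∧ (t : ℕ) < (j + 1) * L
      · simpa [B, ht] using hf t ht.1 ht.2
      · simp [B, ht]
    · funext p t
      have := congrFun (congrFun hfg (t + (w p).getD 0)) p
      simpa [shifted] using this
  have h2 : ∀ t : Fin m, ((B t).card : ℝ) ≤ (N : ℝ) ^ n *
      if j * L ≤ t ∧ (t : ℕ) < (j + 1) * L then
        Real.exp (-((support w).card / (8 * n))) else 1 := by
    intro t
    by_cases ht : j * L ≤ t ∧ (t : ℕ) < (j + 1) * L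
    · simp only [B, if_pos ht]
      refine (card_not_isolated hn hN _).trans ?_
      gcongr _ * Real.exp (-?_)
      have hmono : (awake w (j * L)).card ≤ (awake w t).card := by
        refine Finset.card_le_card fun p hp => ?_
        simp only [awake, Finset.mem_filter, Finset.mem_univ, true_and] at hp ⊢
        obtain ⟨v, hv, hv'⟩ := hp
        exact ⟨v, hv, hv'.trans ht.1⟩
      have hle : ((support w).card : ℝ) ≤ 2 * (awake w t).card := by
        exact_mod_cast hw.trans (Nat.mul_le_mul_left 2 hmono)
      rw [div_le_div_iff₀ (by positivity) (by positivity)]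
      nlinarith
    · simp [B, if_neg ht]
  have h3 : (Finset.univ.filter fun t : Fin m => j * L ≤ t ∧ (t : ℕ) < (j + 1) * L).card = L := by
    have : (Finset.univ.filter fun t : Fin m => j * L ≤ t ∧ (t : ℕ) < (j + 1) * L).map
        Fin.valEmbedding = Finset.Ico (j * L) ((j + 1) * L) := by
      ext t
      simp only [Finset.mem_map, Finset.mem_filter, Finset.mem_univ, true_and,
        Fin.valEmbedding_apply, Finset.mem_Ico]
      constructor
      · rintro ⟨t, ht, rfl⟩; exact ht
      · intro ht; exact ⟨⟨t, ht.2.trans_le hm⟩, ht, rfl⟩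
    rw [← Finset.card_map, this, Nat.card_Ico, Nat.succ_mul]
    omega
  calc ((failures (N := N) L j w).card : ℝ) ≤ ((Fintype.piFinset B).card : ℝ) := by
        exact_mod_cast h1
    _ = ∏ t, ((B t).card : ℝ) := by rw [Fintype.card_piFinset]; push_cast; rfl
    _ ≤ ∏ t : Fin m, ((N : ℝ) ^ n * if j * L ≤ t ∧ (t : ℕ) < (j + 1) * L then
        Real.exp (-((support w).card / (8 * n))) else 1) :=
        Finset.prod_le_prod (fun _ _ => Nat.cast_nonneg _) fun t _ => h2 t
    _ = ((N : ℝ) ^ n) ^ m * Real.exp (-(L / (8 * n))) ^ (support w).card := by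
        rw [Finset.prod_mul_distrib, Finset.prod_const, Finset.card_univ, Fintype.card_fin,
          Finset.prod_ite, Finset.prod_const, h3, Finset.prod_const_one, mul_one,
          ← Real.exp_nat_mul, ← Real.exp_nat_mul]
        congr 2
        field_simp

/-- Expanding the product: each process contributes 1 if it never wakes, and x for each of its m
wake-up rounds. This evaluates the union bound over all wake-up patterns. -/
theorem sum_pow_support (x : ℝ) :
    ∑ w : Fin n → Option (Fin m), x ^ (support w).card = (1 + m * x) ^ n := by
  have h := Finset.prod_univ_sum (fun _ : Fin n => (Finset.univ : Finset (Option (Fin m))))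
    (fun _ o => if o.isSome then x else 1)
  rw [Fintype.piFinset_univ] at h
  simp only [Fintype.sum_option, Option.isSome_none, Option.isSome_some, if_true] at h
  simp only [Finset.sum_const, Finset.card_univ, Fintype.card_fin, Finset.prod_const,
    nsmul_eq_mul] at h
  simp only [Bool.false_eq_true, if_false] at h
  rw [h]
  refine Finset.sum_congr rfl fun w _ => ?_
  rw [Finset.prod_ite, Finset.prod_const, Finset.prod_const_one, mul_one, support]

/-- If the expected number of failures is less than one, some choice never fails. -/
theorem exists_choice [NeZero m] [NeZero N] (hn : 0 < n) (hN : N = 2 * n) {L l : ℕ}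
    (hm : l * L ≤ m)
    (hsmall : (l : ℝ) * ((1 + m * Real.exp (-(L / (8 * n)))) ^ n - 1) < 1) :
    ∃ f : Fin n → Fin m → Fin N, ∀ j < l, ∀ w : Fin n → Option (Fin m),
      (support w).Nonempty → (support w).card ≤ 2 * (awake w (j * L)).card →
      ∃ t : Fin m, j * L ≤ t ∧ (t : ℕ) < (j + 1) * L ∧
        Isolated (awake w t) (shifted w f t) := by
  classical
  set x := Real.exp (-((L : ℝ) / (8 * n))) with hx
  let W : ℕ → Finset (Fin n → Option (Fin m)) := fun j => Finset.univ.filter fun w =>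
    (support w).Nonempty ∧ (support w).card ≤ 2 * (awake w (j * L)).card
  let bad : Finset (Fin n → Fin m → Fin N) :=
    (Finset.range l).biUnion fun j => (W j).biUnion fun w => failures L j w
  have hN0 : (0 : ℝ) < ((N : ℝ) ^ n) ^ m := by
    have : (0 : ℝ) < N := by exact_mod_cast NeZero.pos N
    positivity
  have hx0 : 0 < x := Real.exp_pos _
  -- Removing the pattern in which nobody wakes accounts for the `- 1`.
  have h1 : ∀ j, ∑ w ∈ W j, x ^ (support w).card ≤ (1 + m * x) ^ n - 1 := by
    intro j
    rw [← sum_pow_support, ← Finset.sum_erase_add _ _ (Finset.mem_univ fun _ => none)]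
    have h0 : (support (fun _ => none : Fin n → Option (Fin m))).card = 0 := by simp [support]
    rw [h0, pow_zero, add_sub_cancel_right]
    refine Finset.sum_le_sum_of_subset_of_nonneg (fun w hw => ?_) fun _ _ _ => by positivity
    refine Finset.mem_erase.2 ⟨?_, Finset.mem_univ _⟩
    rintro rfl
    have := (Finset.mem_filter.1 hw).2.1
    rw [← Finset.card_pos, h0] at this
    exact absurd this (lt_irrefl _)
  have h2 : (bad.card : ℝ) < ((N : ℝ) ^ n) ^ m := by
    calc (bad.card : ℝ) ≤ ∑ j ∈ Finset.range l, ∑ w ∈ W j, ((failures (N := N) L j w).card : ℝ) := by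
          have := Finset.card_biUnion_le (s := Finset.range l)
            (t := fun j => (W j).biUnion fun w => failures (N := N) L j w)
          have h := this.trans (Finset.sum_le_sum fun j _ => Finset.card_biUnion_le)
          exact_mod_cast h
      _ ≤ ∑ j ∈ Finset.range l, ((N : ℝ) ^ n) ^ m * ((1 + m * x) ^ n - 1) := by
          refine Finset.sum_le_sum fun j hj => ?_
          refine (Finset.sum_le_sum fun w hw => ?_).trans (b := ∑ w ∈ W j,
            ((N : ℝ) ^ n) ^ m * x ^ (support w).card) ?_
          · refine card_failures hn hN ?_ w (Finset.mem_filter.1 hw).2.2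
            exact (Nat.mul_le_mul_right L (Finset.mem_range.1 hj)).trans hm
          · rw [← Finset.mul_sum]
            exact mul_le_mul_of_nonneg_left (h1 j) hN0.le
      _ = ((N : ℝ) ^ n) ^ m * (l * ((1 + m * x) ^ n - 1)) := by
          rw [Finset.sum_const, Finset.card_range, nsmul_eq_mul]; ring
      _ < ((N : ℝ) ^ n) ^ m := by nlinarith
  have h3 : bad.card < (Finset.univ : Finset (Fin n → Fin m → Fin N)).card := by
    have : (Finset.univ : Finset (Fin n → Fin m → Fin N)).card = (N ^ m) ^ n := by simp
    rw [this]
    have h4 : ((N : ℝ) ^ n) ^ m = (((N ^ m) ^ n : ℕ) : ℝ) := by push_cast; rw [pow_right_comm]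
    rw [h4] at h2
    exact_mod_cast h2
  obtain ⟨f, -, hf⟩ := Finset.exists_mem_notMem_of_card_lt_card h3
  refine ⟨f, fun j hj w hw hw' => ?_⟩
  by_contra hc
  push Not at hc
  refine hf (Finset.mem_biUnion.2 ⟨j, Finset.mem_range.2 hj, Finset.mem_biUnion.2 ⟨w, ?_, ?_⟩⟩)
  · exact Finset.mem_filter.2 ⟨Finset.mem_univ _, hw, hw'⟩
  · exact Finset.mem_filter.2 ⟨Finset.mem_univ _, hc⟩

/-- A sequence that starts at a positive number and stays below `2 ^ l` fails to double
before time `l`. -/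
theorem exists_not_doubling {a : ℕ → ℕ} {l : ℕ} (h0 : 1 ≤ a 0) (hl : a l < 2 ^ l) :
    ∃ j < l, a (j + 1) ≤ 2 * a j := by
  by_contra hc
  push Not at hc
  have : ∀ j ≤ l, 2 ^ j ≤ a j := by
    intro j
    induction j with
    | zero => intro _; simpa using h0
    | succ j ih =>
      intro hj
      have h1 := ih (by omega)
      have h2 := hc j (by omega)
      rw [pow_succ]
      omega
  exact absurd (this l le_rfl) (not_le.2 hl)

/-- The number of awake processes starts at 1 or more and never exceeds n < 2^l, so over one of the
`l` intervals it at most doubles. A choice without failures then succeeds in that interval. -/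
theorem exists_of_small [NeZero m] (hn : 0 < n) {L l : ℕ} (hL : 0 < L) (hm : l * L ≤ m)
    (hl : n < 2 ^ l)
    (hsmall : (l : ℝ) * ((1 + m * Real.exp (-(L / (8 * n)))) ^ n - 1) < 1) :
    ∃ s, IsSynchronizer n m s := by
  classical
  have : NeZero (2 * n) := ⟨by omega⟩
  obtain ⟨f, hf⟩ := exists_choice (N := 2 * n) hn rfl hm hsmall
  refine ⟨fun p i => if h : p < n ∧ i < m then decide (f ⟨p, h.1⟩ ⟨i, h.2⟩ = 0) else false, ?_⟩
  rintro X w ⟨p₀, hp₀, hw₀⟩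
  let a : ℕ → ℕ := fun j => (X.filter fun p => w p ≤ j * L).card
  obtain ⟨j, hj, haj⟩ : ∃ j < l, a (j + 1) ≤ 2 * a j := by
    refine exists_not_doubling (Finset.card_pos.2 ⟨p₀, ?_⟩) (lt_of_le_of_lt ?_ hl)
    · simp [hp₀, hw₀]
    · exact (Finset.card_le_univ _).trans (by simp)
  have hjm : (j + 1) * L ≤ m := (Nat.mul_le_mul_right L hj).trans hm
  have hjL : (j + 1) * L = j * L + L := Nat.succ_mul j L
  -- Processes that wake only after the interval are treated as never waking. This makes the support
  -- at most the number awake at time `(j + 1) * L`.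
  let w' : Fin n → Option (Fin m) := fun p =>
    if h : p ∈ X ∧ w p < (j + 1) * L then some ⟨w p, h.2.trans_le hjm⟩ else none
  have hw' : ∀ p, ∀ h : p ∈ X ∧ w p < (j + 1) * L, w' p = some ⟨w p, h.2.trans_le hjm⟩ :=
    fun p h => dif_pos h
  have hw'' : ∀ p v, w' p = some v → p ∈ X ∧ w p < (j + 1) * L ∧ (v : ℕ) = w p := by
    intro p v hv
    by_cases h : p ∈ X ∧ w p < (j + 1) * L
    · rw [hw' p h] at hv
      cases hv
      exact ⟨h.1, h.2, rfl⟩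
    · simp [w', h] at hv
  have hsupp : (support w').card ≤ a (j + 1) := by
    refine Finset.card_le_card fun p hp => ?_
    obtain ⟨v, hv⟩ := Option.isSome_iff_exists.1 (Finset.mem_filter.1 hp).2
    obtain ⟨h1, h2, -⟩ := hw'' p v hv
    exact Finset.mem_filter.2 ⟨h1, h2.le⟩
  have hawake : a j ≤ (awake w' (j * L)).card := by
    refine Finset.card_le_card fun p hp => ?_
    obtain ⟨h1, h2⟩ := Finset.mem_filter.1 hp
    exact Finset.mem_filter.2 ⟨Finset.mem_univ _, _, hw' p ⟨h1, by omega⟩, h2⟩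
  have hne : (support w').Nonempty :=
    ⟨p₀, Finset.mem_filter.2 ⟨Finset.mem_univ _, by rw [hw' p₀ ⟨hp₀, by omega⟩]; rfl⟩⟩
  obtain ⟨t, ht1, ht2, p, hp, hp0, hpq⟩ := hf j hj w' hne (by omega)
  have hval : ∀ q, q ∈ X → w q ≤ t → ∃ h : t - w q < m,
      shifted w' f t q = f q ⟨t - w q, h⟩ := by
    intro q hq hqt
    refine ⟨by omega, ?_⟩
    rw [shifted, hw' q ⟨hq, by omega⟩, Option.getD_some]
    congr 1
    -- The cyclic subtraction does not wrap around for a process that is already awake.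
    exact Fin.ext (Fin.sub_val_of_le hqt)
  obtain ⟨v, hv, hvt⟩ := (Finset.mem_filter.1 hp).2
  obtain ⟨h1, h2, h3⟩ := hw'' p v hv
  rw [h3] at hvt
  refine ⟨t, t.2, p, h1, hvt, ?_, fun q hq hqp hqt => ?_⟩
  · obtain ⟨h, he⟩ := hval p h1 hvt
    rw [he] at hp0
    simp [h, hp0]
  · obtain ⟨h, he⟩ := hval q hq hqt
    have := hpq q hqp
    rw [he] at this
    simp [h, this]

end Synchronizer

/-- There are synchronizers of length `O(n log² n)`. -/
theorem exists_synchronizer {n : ℕ} (hn : 0 < n) :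
    ∃ s, IsSynchronizer n (128 * n * n.size ^ 2) s := by
  set l := n.size with hl
  have hl1 : 1 ≤ l := Nat.size_pos.2 hn
  have hnl : n < 2 ^ l := Nat.lt_size_self n
  have hll : l < 2 ^ l := Nat.lt_two_pow_self
  have hm : 0 < 128 * n * l ^ 2 := by positivity
  have : NeZero (128 * n * l ^ 2) := ⟨hm.ne'⟩
  refine Synchronizer.exists_of_small hn (L := 128 * n * l) (l := l) (by positivity)
    (le_of_eq (by ring)) hnl ?_
  have hn' : (0 : ℝ) < n := by exact_mod_cast hn
  -- Everything is compared with powers of y, which exceeds both n and l. The factor 128 makes the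
  -- exponent 16l, so x ≤ y^(-16), while n·m ≤ 128·y^4; this leaves l·z ≤ 128·y^(-11) ≤ 1/16.
  set y : ℝ := 2 ^ l with hy
  have hy2 : 2 ≤ y := by
    calc (2 : ℝ) = 2 ^ 1 := by norm_num
      _ ≤ 2 ^ l := pow_le_pow_right₀ (by norm_num) hl1
  have hny : (n : ℝ) ≤ y := by rw [hy]; exact_mod_cast hnl.le
  have hly : (l : ℝ) ≤ y := by rw [hy]; exact_mod_cast hll.le
  have hl0 : (0 : ℝ) ≤ l := Nat.cast_nonneg _
  have hexp : Real.exp (-(((128 * n * l : ℕ) : ℝ) / (8 * n))) ≤ (y ^ 16)⁻¹ := by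
    have he : ((128 * n * l : ℕ) : ℝ) / (8 * n) = ((16 * l : ℕ) : ℝ) * 1 := by
      push_cast; field_simp; ring
    rw [he, Real.exp_neg, Real.exp_nat_mul]
    refine inv_anti₀ (by positivity) ?_
    rw [hy, ← pow_mul, mul_comm l 16]
    refine pow_le_pow_left₀ (by norm_num) ?_ _
    have := Real.add_one_le_exp (1 : ℝ)
    linarith
  set x := Real.exp (-(((128 * n * l : ℕ) : ℝ) / (8 * n))) with hx
  have hx0 : 0 ≤ x := (Real.exp_pos _).le
  set z : ℝ := n * (((128 * n * l ^ 2 : ℕ) : ℝ) * x) with hz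
  have hz0 : 0 ≤ z := by positivity
  have hz1 : z ≤ 128 * (y ^ 12)⁻¹ := by
    have h1 : (n : ℝ) * ((128 * n * l ^ 2 : ℕ) : ℝ) ≤ 128 * y ^ 4 := by
      push_cast
      calc (n : ℝ) * (128 * n * l ^ 2) = 128 * (n * n * l ^ 2) := by ring
        _ ≤ 128 * (y * y * y ^ 2) := by gcongr
        _ = 128 * y ^ 4 := by ring
    calc z = (n : ℝ) * ((128 * n * l ^ 2 : ℕ) : ℝ) * x := by rw [hz]; ring
      _ ≤ 128 * y ^ 4 * (y ^ 16)⁻¹ := by gcongr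
      _ = 128 * (y ^ 12)⁻¹ := by field_simp
  have hy11 : (2048 : ℝ) ≤ y ^ 11 := by
    calc (2048 : ℝ) = 2 ^ 11 := by norm_num
      _ ≤ y ^ 11 := pow_le_pow_left₀ (by norm_num) hy2 _
  have hlz : (l : ℝ) * z ≤ 1 / 16 := by
    calc (l : ℝ) * z ≤ y * (128 * (y ^ 12)⁻¹) := by gcongr
      _ = 128 * (y ^ 11)⁻¹ := by field_simp
      _ ≤ 128 * (2048)⁻¹ := by gcongr
      _ = 1 / 16 := by norm_num
  have hzle : z ≤ 1 := by
    have : (1 : ℝ) ≤ l := by exact_mod_cast hl1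
    nlinarith
  have hpow : (1 + ((128 * n * l ^ 2 : ℕ) : ℝ) * x) ^ n ≤ 1 + 2 * z := by
    calc (1 + ((128 * n * l ^ 2 : ℕ) : ℝ) * x) ^ n
        ≤ Real.exp (((128 * n * l ^ 2 : ℕ) : ℝ) * x) ^ n := by
          refine pow_le_pow_left₀ (by positivity) ?_ _
          rw [add_comm]; exact Real.add_one_le_exp _
      _ = Real.exp z := by rw [← Real.exp_nat_mul]
      _ ≤ 1 + 2 * z := by
          have := Real.abs_exp_sub_one_le (x := z) (by rw [abs_of_nonneg hz0]; exact hzle)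
          rw [abs_of_nonneg hz0] at this
          have := le_abs_self (Real.exp z - 1)
          linarith
  calc (l : ℝ) * ((1 + ((128 * n * l ^ 2 : ℕ) : ℝ) * x) ^ n - 1) ≤ l * (2 * z) := by
        gcongr; linarith
    _ < 1 := by linarith

/-! ### The wake-up algorithm, for the channel without collision detection -/

/-- The modes of a process in the entry section of the wake-up algorithm: listening (having heard a
given number of silent rounds), having to wait for a given number of rounds for its turn after
another process has left the critical section, or having performed a given number of rounds of its
schedule. -/
inductive WakeMode
  | listen (c : ℕ)
  | turn (d : ℕ)
  | active (i : ℕ)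

/-- The number of labels strictly between `q` and `p` in the cyclic order of `0, …, n - 1`. -/
def between (n q p : ℕ) : ℕ := if q < p then p - q - 1 else p + n - q - 1

/-- The algorithm for the channel without collision detection. After `m` silent rounds the waiting
processes run their schedules `s`, of length `m`, until they hear another process. A process that
leaves the critical section announces its label, which starts a round robin. -/
abbrev wakeAlg (n m : ℕ) (s : ℕ → ℕ → Bool) : Algorithm where
  Msg := Option ℕ
  State := ℕ × WakeMode
  init p := (p, .listen 0)
  entryAction st := match st.2 with
    | .active i => if s st.1 i then .transmit none else .listen
    | _ => .listen
  entryStep st r := match st.2, r with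
    | .listen _, some (.message (.regular (some q))) => ((st.1, .turn (between n q st.1)), false)
    | _, some (.message _) => ((st.1, .listen 0), false)
    | .listen c, _ => ((st.1, if c + 1 = m then .active 0 else .listen (c + 1)), false)
    | .turn d, _ => ((st.1, .turn (d - 1)), decide (d = 0))
    | .active i, _ => ((st.1, .active (i + 1)), decide (i + 1 = m))
  exitAction st := .transmit (some st.1)
  exitStep st _ := ((st.1, .listen 0), true)

namespace Wake

/-- The section of a process together with its mode if it is in the entry section. -/
inductive View
  | rem
  | listen (c : ℕ)
  | turn (d : ℕ)
  | active (i : ℕ)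
  | crit
  | exit

def view (c : Config (ℕ × WakeMode)) : View :=
  match c.sec with
  | .remainder => .rem
  | .critical => .crit
  | .exit => .exit
  | .entry => match c.state.2 with
    | .listen k => .listen k
    | .turn d => .turn d
    | .active i => .active i

/-- The state carries the label `p`, and is the initial one in the remainder section. -/
def Good (p : ℕ) (c : Config (ℕ × WakeMode)) : Prop :=
  c.state.1 = p ∧ (c.sec = .remainder → c.state.2 = .listen 0)

theorem sec_critical_iff {c : Config (ℕ × WakeMode)} : c.sec = .critical ↔ view c = .crit := by
  rcases c with ⟨s, ⟨l, m⟩, cy, e⟩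
  cases s <;> cases m <;> simp [view]

theorem sec_entry_iff {c : Config (ℕ × WakeMode)} : c.sec = .entry ↔
    (∃ k, view c = .listen k) ∨ (∃ d, view c = .turn d) ∨ ∃ i, view c = .active i := by
  rcases c with ⟨s, ⟨l, m⟩, cy, e⟩
  cases s <;> cases m <;> simp [view]

section Local

variable {n m : ℕ} {s : ℕ → ℕ → Bool} {σ : Stream'.Seq (ℕ+ × ℕ+)}
  {r : Option (Feedback (Option ℕ))} {c : Config (ℕ × WakeMode)} {p : ℕ}

local notation "adv" => advance (wakeAlg n m s)
local notation "tr" => transmission (wakeAlg n m s)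

theorem good_advance (h : Good p c) : Good p (adv σ r c) := by
  rcases hs : c.sec
  · obtain ⟨h1, h2⟩ := advance_remainder (A := wakeAlg n m s) (σ := σ) (r := r) hs
    exact ⟨by rw [h1]; exact h.1, fun _ => by rw [h1]; exact h.2 hs⟩
  · obtain ⟨h1, h2⟩ := advance_entry (A := wakeAlg n m s) (σ := σ) (r := r) hs
    refine ⟨?_, fun h3 => ?_⟩
    · rw [h1]
      have := h.1
      simp only
      split <;> exact this
    · rw [h3] at h2
      split_ifs at h2
  · obtain ⟨h1, h2⟩ := advance_critical (A := wakeAlg n m s) (σ := σ) (r := r) hs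
    refine ⟨by rw [h1]; exact h.1, fun h3 => ?_⟩
    rw [h3] at h2
    rcases h2 with ⟨h2, -⟩ | h2 <;> cases h2
  · obtain ⟨h1, h2⟩ := advance_exit (A := wakeAlg n m s) (σ := σ) (r := r) hs rfl
    exact ⟨by rw [h1]; exact h.1, fun _ => by rw [h1]⟩

theorem view_of_rem (h : Good p c) (hv : view c = .rem) :
    view (adv σ r c) = .rem ∨ view (adv σ r c) = .listen 0 := by
  have hs : c.sec = .remainder := by
    rcases c with ⟨s, ⟨l, m⟩, cy, e⟩
    cases s <;> cases m <;> simp_all [view]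
  obtain ⟨h1, h2⟩ := advance_remainder (A := wakeAlg n m s) (σ := σ) (r := r) hs
  have h3 := h.2 hs
  rcases h2 with h2 | h2
  · left; simp [view, h2]
  · right; simp [view, h2, h1, h3]

theorem view_of_exit (hv : view c = .exit) : view (adv σ r c) = .rem := by
  have hs : c.sec = .exit := by
    rcases c with ⟨s, ⟨l, m⟩, cy, e⟩
    cases s <;> cases m <;> simp_all [view]
  obtain ⟨h1, h2⟩ := advance_exit (A := wakeAlg n m s) (σ := σ) (r := r) hs rfl
  simp [view, h2]

theorem view_of_crit (hv : view c = .crit) :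
    (view (adv σ r c) = .crit ∧ remainingCritical σ (adv σ r c) < remainingCritical σ c) ∨
      view (adv σ r c) = .exit := by
  obtain ⟨h1, h2⟩ := advance_critical (A := wakeAlg n m s) (σ := σ) (r := r)
    (sec_critical_iff.2 hv)
  rcases h2 with ⟨h2, h3⟩ | h2
  · exact Or.inl ⟨sec_critical_iff.1 h2, h3⟩
  · right; simp [view, h2]

theorem sec_mode_of_listen {k : ℕ} (hv : view c = .listen k) :
    c.sec = .entry ∧ c.state.2 = .listen k := by
  rcases c with ⟨s, ⟨l, m⟩, cy, e⟩
  cases s <;> cases m <;> simp_all [view]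

theorem sec_mode_of_turn {d : ℕ} (hv : view c = .turn d) :
    c.sec = .entry ∧ c.state.2 = .turn d := by
  rcases c with ⟨s, ⟨l, m⟩, cy, e⟩
  cases s <;> cases m <;> simp_all [view]

theorem sec_mode_of_active {i : ℕ} (hv : view c = .active i) :
    c.sec = .entry ∧ c.state.2 = .active i := by
  rcases c with ⟨s, ⟨l, m⟩, cy, e⟩
  cases s <;> cases m <;> simp_all [view]

theorem view_of_listen_silence {k : ℕ} (hv : view c = .listen k) (hr : r = some .silence) :
    view (adv σ r c) = if k + 1 = m then .active 0 else .listen (k + 1) := by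
  obtain ⟨hs, hm⟩ := sec_mode_of_listen hv
  obtain ⟨h1, h2⟩ := advance_entry (A := wakeAlg n m s) (σ := σ) (r := r) hs
  split_ifs with h <;> simp_all [view]

theorem view_of_listen_exit {k q : ℕ} (hg : Good p c) (hv : view c = .listen k)
    (hr : r = some (.message (.regular (some q)))) :
    view (adv σ r c) = .turn (between n q p) := by
  obtain ⟨hs, hm⟩ := sec_mode_of_listen hv
  obtain ⟨h1, h2⟩ := advance_entry (A := wakeAlg n m s) (σ := σ) (r := r) hs
  have := hg.1
  simp_all [view]

theorem view_of_listen_message {k : ℕ} {x : Signal (Option ℕ)} (hv : view c = .listen k)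
    (hr : r = some (.message x)) (hx : x = .critical ∨ x = .regular none) :
    view (adv σ r c) = .listen 0 := by
  obtain ⟨hs, hm⟩ := sec_mode_of_listen hv
  obtain ⟨h1, h2⟩ := advance_entry (A := wakeAlg n m s) (σ := σ) (r := r) hs
  rcases hx with rfl | rfl <;> simp_all [view]

theorem view_of_turn_silence {d : ℕ} (hv : view c = .turn d) (hr : r = some .silence) :
    view (adv σ r c) = if d = 0 then .crit else .turn (d - 1) := by
  obtain ⟨hs, hm⟩ := sec_mode_of_turn hv
  obtain ⟨h1, h2⟩ := advance_entry (A := wakeAlg n m s) (σ := σ) (r := r) hs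
  split_ifs with h <;> simp_all [view]

theorem view_of_turn_message {d : ℕ} {x : Signal (Option ℕ)} (hv : view c = .turn d)
    (hr : r = some (.message x)) : view (adv σ r c) = .listen 0 := by
  obtain ⟨hs, hm⟩ := sec_mode_of_turn hv
  obtain ⟨h1, h2⟩ := advance_entry (A := wakeAlg n m s) (σ := σ) (r := r) hs
  simp_all [view]

theorem view_of_active {i : ℕ} (hv : view c = .active i) (hr : r = none ∨ r = some .silence) :
    view (adv σ r c) = if i + 1 = m then .crit else .active (i + 1) := by
  obtain ⟨hs, hm⟩ := sec_mode_of_active hv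
  obtain ⟨h1, h2⟩ := advance_entry (A := wakeAlg n m s) (σ := σ) (r := r) hs
  split_ifs with h <;> rcases hr with rfl | rfl <;> simp_all [view]

theorem view_of_active_message {i : ℕ} {x : Signal (Option ℕ)} (hv : view c = .active i)
    (hr : r = some (.message x)) : view (adv σ r c) = .listen 0 := by
  obtain ⟨hs, hm⟩ := sec_mode_of_active hv
  obtain ⟨h1, h2⟩ := advance_entry (A := wakeAlg n m s) (σ := σ) (r := r) hs
  simp_all [view]

theorem tr_rem (hv : view c = .rem) : tr c = none := by
  rcases c with ⟨s, ⟨l, m⟩, cy, e⟩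
  cases s <;> cases m <;> simp_all [view, transmission]

theorem tr_listen {k : ℕ} (hv : view c = .listen k) : tr c = none := by
  obtain ⟨hs, hm⟩ := sec_mode_of_listen hv
  simp [transmission, hs, hm]

theorem tr_turn {d : ℕ} (hv : view c = .turn d) : tr c = none := by
  obtain ⟨hs, hm⟩ := sec_mode_of_turn hv
  simp [transmission, hs, hm]

theorem tr_active {i : ℕ} (hg : Good p c) (hv : view c = .active i) :
    tr c = if s p i then some (.regular none) else none := by
  obtain ⟨hs, hm⟩ := sec_mode_of_active hv
  have := hg.1
  split_ifs with h <;> simp_all [transmission]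

theorem tr_crit (hv : view c = .crit) : tr c = some .critical := by
  have hs := sec_critical_iff.2 hv
  simp [transmission, hs]

theorem tr_exit (hg : Good p c) (hv : view c = .exit) : tr c = some (.regular (some p)) := by
  have := hg.1
  rcases c with ⟨s, ⟨l, m⟩, cy, e⟩
  cases s <;> cases m <;> simp_all [view, transmission]

end Local

theorem between_lt {n q p : ℕ} (hp : p < n) : between n q p < n := by
  unfold between; split_ifs <;> omega

/-- Distinct labels get distinct delays, so no two processes take their turn in the same round. -/
theorem between_inj {n q p p' : ℕ} (hq : q < n) (hp : p < n) (hp' : p' < n)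
    (h : between n q p = between n q p') : p = p' := by
  unfold between at h; split_ifs at h <;> omega

/-- If p comes before p' in the cyclic order starting after q, then p' is closer to p than to q.
This is the progress of a process that is passed over in the round robin. -/
theorem between_lt_between {n q p p' : ℕ} (hq : q < n) (hp' : p' < n)
    (h : between n q p < between n q p') : between n p p' < between n q p' := by
  unfold between at *; split_ifs at * <;> omega

/-! ### Phases and progress measures of the wake-up algorithm -/

/-- The phases of an execution of the wake-up algorithm. -/
inductive Phase (n : ℕ)
  | idle (g : ℕ)
  | wake (τ : ℕ)
  | solo (q : Fin n) (i : ℕ)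
  | turns (q : Fin n) (e : ℕ)
  | crit (q : Fin n)
  | exit (q : Fin n)

variable {n m : ℕ} {s : ℕ → ℕ → Bool}

/-- When the active processes are in round `τ` of a wake-up, exactly one of them transmitted in
round `t`. -/
def Success (s : ℕ → ℕ → Bool) (c : Fin n → Config (ℕ × WakeMode)) (τ t : ℕ) : Prop :=
  ∃ p i, view (c p) = .active i ∧ τ - i ≤ t ∧ s p (t - (τ - i)) = true ∧
    ∀ q j, q ≠ p → view (c q) = .active j → τ - j ≤ t → s q (t - (τ - j)) = false

/-- In `wake τ` the oldest active process has played τ rounds. In `solo`, the strict bound k < i on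
the silence counters lets the soloist finish first. In `turns q e`, the constant sum e + d keeps the
delays distinct. Countdowns left over in `crit` are erased by the first critical message, hence are
absent from `exit`. -/
def PhaseInv (m : ℕ) (s : ℕ → ℕ → Bool) (φ : Phase n)
    (c : Fin n → Config (ℕ × WakeMode)) : Prop :=
  match φ with
  | .idle g => g < m ∧ (∀ p, view (c p) = .rem ∨ ∃ k ≤ g, view (c p) = .listen k) ∧
      (g = 0 ∨ ∃ p, view (c p) = .listen g)
  | .wake τ => τ < m ∧ (∀ p, view (c p) = .rem ∨ (∃ k < m, view (c p) = .listen k) ∨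
      ∃ i ≤ τ, view (c p) = .active i) ∧ (∃ p, view (c p) = .active τ) ∧
      ∀ t < τ, ¬ Success s c τ t
  | .solo q i => i < m ∧ view (c q) = .active i ∧
      ∀ p, p ≠ q → view (c p) = .rem ∨ ∃ k < i, view (c p) = .listen k
  | .turns q e => (∀ p, view (c p) = .rem ∨ (∃ k ≤ e, view (c p) = .listen k) ∨
      ∃ d, view (c p) = .turn d ∧ e + d = between n q p) ∧ ∃ p d, view (c p) = .turn d
  | .crit q => view (c q) = .crit ∧ ∀ p, p ≠ q →
      view (c p) = .rem ∨ (∃ k, view (c p) = .listen k) ∨ ∃ d, view (c p) = .turn d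
  | .exit q => view (c q) = .exit ∧
      ∀ p, p ≠ q → view (c p) = .rem ∨ view (c p) = .listen 0

def Inv (m : ℕ) (s : ℕ → ℕ → Bool) (φ : Phase n) (c : Fin n → Config (ℕ × WakeMode)) : Prop :=
  (∀ p : Fin n, Good p (c p)) ∧ PhaseInv m s φ c

def rank (m : ℕ) : Phase n → ℕ
  | .idle g => 2 * m + (m - g)
  | .wake τ => m + (m - τ)
  | .solo _ i => m - i
  | .turns _ e => n - e
  | .crit _ => 0
  | .exit _ => 3 * m + 1

/-- The cyclic distance from the last process admitted; `n` stands for a process that has no place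
in the current round robin, and exceeds every distance. -/
def major (φ : Phase n) (c : Fin n → Config (ℕ × WakeMode)) (p : Fin n) : ℕ :=
  match φ, view (c p) with
  | .crit q, _ => between n q p
  | .exit q, _ => between n q p
  | .turns q _, .turn _ => between n q p
  | _, _ => n

def minor (m : ℕ) (σ : Strategy n) (φ : Phase n) (c : Fin n → Config (ℕ × WakeMode)) : ℕ :=
  match φ with
  | .crit q => n + 2 + remainingCritical (σ q) (c q)
  | .exit _ => n + 1
  | φ => rank m φ

/-- What has to be shown about one round that starts in phase `φ`. -/
def StepGoal (m : ℕ) (s : ℕ → ℕ → Bool) (σ : Strategy n) (φ : Phase n)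
    (c : Fin n → Config (ℕ × WakeMode)) : Prop :=
  ∃ φ', PhaseInv m s φ' (step (wakeAlg n m s) false σ c) ∧
    ((∃ p, (c p).sec = .entry) → (∀ p, (c p).sec ≠ .critical) → rank m φ' < rank m φ) ∧
    ∀ p, (c p).sec = .entry → (step (wakeAlg n m s) false σ c p).sec = .critical ∨
      major φ' (step (wakeAlg n m s) false σ c) p < major φ c p ∨
      (major φ' (step (wakeAlg n m s) false σ c) p ≤ major φ c p ∧
        minor m σ φ' (step (wakeAlg n m s) false σ c) < minor m σ φ c)

section Step

variable {σ : Strategy n} {c : Fin n → Config (ℕ × WakeMode)}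

local notation "stp" => step (wakeAlg n m s) false σ c
local notation "trs" => fun q => transmission (wakeAlg n m s) (c q)

theorem reception_message {p q : Fin n} {x : Signal (Option ℕ)}
    (hq : transmission (wakeAlg n m s) (c q) = some x)
    (h : ∀ p, p ≠ q → transmission (wakeAlg n m s) (c p) = none) (hp : p ≠ q) :
    reception false (trs) p = some (.message x) := by
  rw [reception_of_eq_none (tx := trs) (h p hp), channel_eq_message (tx := trs) hq h]
  rfl

theorem reception_silence {p : Fin n}
    (h : ∀ p, transmission (wakeAlg n m s) (c p) = none) :
    reception false (trs) p = some .silence := by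
  rw [reception_of_eq_none (tx := trs) (h p), channel_eq_silence (tx := trs) h]
  rfl

theorem stepGoal_idle (hg : ∀ p : Fin n, Good p (c p)) {g : ℕ}
    (h : PhaseInv m s (.idle g) c) : StepGoal m s σ (.idle g) c := by
  obtain ⟨hgm, h, hex⟩ := h
  have htr : ∀ p, transmission (wakeAlg n m s) (c p) = none := fun p =>
    (h p).elim tr_rem fun ⟨_, _, hk⟩ => tr_listen hk
  have hl : ∀ p k, view (c p) = .listen k →
      view (stp p) = if k + 1 = m then .active 0 else .listen (k + 1) := fun p k hp =>
    view_of_listen_silence hp (reception_silence htr)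
  have hrem : ∀ p, view (c p) = .rem → view (stp p) = .rem ∨ view (stp p) = .listen 0 :=
    fun p hp => view_of_rem (hg p) hp
  by_cases he : ∃ p, view (c p) = .listen g
  · obtain ⟨p₀, hp₀⟩ := he
    by_cases hm : g + 1 = m
    · refine ⟨.wake 0, ⟨by omega, fun p => ?_, ⟨p₀, by rw [hl p₀ g hp₀, if_pos hm]⟩,
        fun t ht => by omega⟩, fun _ _ => by simp only [rank]; omega,
        fun p hp => Or.inr (Or.inr ⟨by simp [major], by simp only [minor, rank]; omega⟩)⟩
      rcases h p with h | ⟨k, hk, h⟩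
      · rcases hrem p h with h | h
        · exact Or.inl h
        · exact Or.inr (Or.inl ⟨0, by omega, h⟩)
      · have := hl p k h
        split_ifs at this with hk'
        · exact Or.inr (Or.inr ⟨0, le_rfl, this⟩)
        · exact Or.inr (Or.inl ⟨k + 1, by omega, this⟩)
    · refine ⟨.idle (g + 1), ⟨by omega, fun p => ?_,
        Or.inr ⟨p₀, by rw [hl p₀ g hp₀, if_neg hm]⟩⟩, fun _ _ => by simp only [rank]; omega,
        fun p hp => Or.inr (Or.inr ⟨by simp [major], by simp only [minor, rank]; omega⟩)⟩
      rcases h p with h | ⟨k, hk, h⟩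
      · rcases hrem p h with h | h
        · exact Or.inl h
        · exact Or.inr ⟨0, by omega, h⟩
      · have := hl p k h
        rw [if_neg (by omega)] at this
        exact Or.inr ⟨k + 1, by omega, this⟩
  · obtain rfl : g = 0 := hex.resolve_right he
    have hall : ∀ p, view (c p) = .rem := fun p => (h p).resolve_right fun ⟨k, hk, h⟩ =>
      he ⟨p, by rw [h, Nat.le_zero.1 hk]⟩
    have hne : ∀ p, (c p).sec ≠ .entry := fun p hp => by
      rw [sec_entry_iff, hall p] at hp; simp at hp
    exact ⟨.idle 0, ⟨hgm, fun p => (hrem p (hall p)).imp id fun h => ⟨0, le_rfl, h⟩, Or.inl rfl⟩,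
      fun ⟨p, hp⟩ => absurd hp (hne p), fun p hp => absurd hp (hne p)⟩

theorem stepGoal_solo (hg : ∀ p : Fin n, Good p (c p)) {q : Fin n} {i : ℕ}
    (h : PhaseInv m s (.solo q i) c) : StepGoal m s σ (.solo q i) c := by
  obtain ⟨him, hq, h⟩ := h
  have htr : ∀ p, p ≠ q → transmission (wakeAlg n m s) (c p) = none := fun p hp =>
    (h p hp).elim tr_rem fun ⟨_, _, hk⟩ => tr_listen hk
  have htq : transmission (wakeAlg n m s) (c q) = if s q i then some (.regular none) else none :=
    tr_active (hg q) hq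
  have hrem : ∀ p, view (c p) = .rem → view (stp p) = .rem ∨ view (stp p) = .listen 0 :=
    fun p hp => view_of_rem (hg p) hp
  have hqv : view (stp q) = if i + 1 = m then .crit else .active (i + 1) := by
    refine view_of_active hq ?_
    by_cases hs : s q i = true
    · rw [if_pos hs] at htq
      exact Or.inl (reception_of_eq_some htq)
    · rw [if_neg hs] at htq
      refine Or.inr (reception_silence fun p => ?_)
      by_cases hp : p = q
      · rw [hp]; exact htq
      · exact htr p hp
  have hoth : ∀ p, p ≠ q → view (stp p) = .rem ∨ ∃ k < i + 1, view (stp p) = .listen k := by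
    intro p hp
    rcases h p hp with h | ⟨k, hk, h⟩
    · exact (hrem p h).imp id fun h => ⟨0, by omega, h⟩
    · right
      by_cases hs : s q i = true
      · rw [if_pos hs] at htq
        exact ⟨0, by omega, view_of_listen_message h (reception_message htq htr hp) (Or.inr rfl)⟩
      · rw [if_neg hs] at htq
        have : view (stp p) = _ := view_of_listen_silence h (reception_silence fun p => by
          by_cases hp : p = q
          · rw [hp]; exact htq
          · exact htr p hp)
        -- Here k + 1 ≤ i < m, so no listener becomes active during the solo.
        rw [if_neg (by omega)] at this
        exact ⟨k + 1, by omega, this⟩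
  by_cases hm : i + 1 = m
  · rw [if_pos hm] at hqv
    refine ⟨.crit q, ⟨hqv, fun p hp => ?_⟩, fun _ _ => by simp only [rank]; omega,
      fun p hp => Or.inr (Or.inl ?_)⟩
    · rcases hoth p hp with h | ⟨k, -, h⟩ <;> simp [h]
    · simpa only [major] using between_lt p.2
  · rw [if_neg hm] at hqv
    exact ⟨.solo q (i + 1), ⟨by omega, hqv, hoth⟩, fun _ _ => by simp only [rank]; omega,
      fun p hp => Or.inr (Or.inr ⟨by simp [major], by simp only [minor, rank]; omega⟩)⟩

theorem stepGoal_crit (hg : ∀ p : Fin n, Good p (c p)) {q : Fin n}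
    (h : PhaseInv m s (.crit q) c) : StepGoal m s σ (.crit q) c := by
  obtain ⟨hq, h⟩ := h
  have htr : ∀ p, p ≠ q → transmission (wakeAlg n m s) (c p) = none := fun p hp => by
    rcases h p hp with h | ⟨k, h⟩ | ⟨d, h⟩
    exacts [tr_rem h, tr_listen h, tr_turn h]
  have hr : ∀ p, p ≠ q → reception false (trs) p = some (.message .critical) := fun p hp =>
    reception_message (tr_crit hq) htr hp
  have hoth : ∀ p, p ≠ q → view (stp p) = .rem ∨ view (stp p) = .listen 0 := by
    intro p hp
    rcases h p hp with h | ⟨k, h⟩ | ⟨d, h⟩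
    · exact view_of_rem (hg p) h
    · exact Or.inr (view_of_listen_message h (hr p hp) (Or.inl rfl))
    · exact Or.inr (view_of_turn_message h (hr p hp))
  have hnc : ∀ {P : Prop}, (∃ p, (c p).sec = .entry) → (∀ p, (c p).sec ≠ .critical) → P :=
    fun _ h => absurd (sec_critical_iff.2 hq) (h q)
  have := view_of_crit (n := n) (m := m) (s := s) (σ := σ q) (r := reception false (trs) q) hq
  rcases this with ⟨h1, h2⟩ | h1
  · refine ⟨.crit q, ⟨h1, fun p hp => ?_⟩, hnc, fun p hp => Or.inr (Or.inr ⟨le_rfl, ?_⟩)⟩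
    · rcases hoth p hp with h | h <;> simp [h]
    · exact Nat.add_lt_add_left h2 _
  · exact ⟨.exit q, ⟨h1, hoth⟩, hnc, fun p hp => Or.inr (Or.inr ⟨le_rfl, by
      simp only [minor]; omega⟩)⟩

theorem stepGoal_exit (hg : ∀ p : Fin n, Good p (c p)) (hnm : n < m) {q : Fin n}
    (h : PhaseInv m s (.exit q) c) : StepGoal m s σ (.exit q) c := by
  obtain ⟨hq, h⟩ := h
  have htr : ∀ p, p ≠ q → transmission (wakeAlg n m s) (c p) = none := fun p hp =>
    (h p hp).elim tr_rem tr_listen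
  have hl : ∀ p, p ≠ q → view (c p) = .listen 0 → view (stp p) = .turn (between n q p) :=
    fun p hp hv => view_of_listen_exit (hg p) hv (reception_message (tr_exit (hg q) hq) htr hp)
  have hrem : ∀ p, view (c p) = .rem → view (stp p) = .rem ∨ view (stp p) = .listen 0 :=
    fun p hp => view_of_rem (hg p) hp
  have hqv : view (stp q) = .rem := view_of_exit hq
  have hent : ∀ p, (c p).sec = .entry → p ≠ q ∧ view (c p) = .listen 0 := by
    intro p hp
    have hne : p ≠ q := by
      rintro rfl; rw [sec_entry_iff, hq] at hp; simp at hp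
    refine ⟨hne, (h p hne).resolve_left fun h => ?_⟩
    rw [sec_entry_iff, h] at hp; simp at hp
  by_cases hex : ∃ p, (c p).sec = .entry
  · obtain ⟨p₀, hp₀⟩ := hex
    obtain ⟨hne₀, hv₀⟩ := hent p₀ hp₀
    refine ⟨.turns q 0, ⟨fun p => ?_, ⟨p₀, _, hl p₀ hne₀ hv₀⟩⟩,
      fun _ _ => by simp only [rank]; omega, fun p hp => ?_⟩
    · by_cases hp : p = q
      · rw [hp]; exact Or.inl hqv
      · rcases h p hp with h | h
        · exact (hrem p h).imp id fun h => Or.inl ⟨0, le_rfl, h⟩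
        · exact Or.inr (Or.inr ⟨_, hl p hp h, Nat.zero_add _⟩)
    · obtain ⟨hne, hv⟩ := hent p hp
      refine Or.inr (Or.inr ⟨?_, by simp only [minor, rank]; omega⟩)
      simp [major, hl p hne hv]
  · refine ⟨.idle 0, ⟨by omega, fun p => ?_, Or.inl rfl⟩, fun h => absurd h hex,
      fun p hp => absurd ⟨p, hp⟩ hex⟩
    by_cases hp : p = q
    · rw [hp]; exact Or.inl hqv
    · rcases h p hp with h' | h'
      · exact (hrem p h').imp id fun h => ⟨0, le_rfl, h⟩
      · exact absurd ⟨p, sec_entry_iff.2 (Or.inl ⟨0, h'⟩)⟩ hex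

theorem stepGoal_turns (hg : ∀ p : Fin n, Good p (c p)) (hnm : n < m) {q : Fin n} {e : ℕ}
    (h : PhaseInv m s (.turns q e) c) : StepGoal m s σ (.turns q e) c := by
  obtain ⟨h, p₀, d₀, hp₀⟩ := h
  have htr : ∀ p, transmission (wakeAlg n m s) (c p) = none := fun p => by
    rcases h p with h | ⟨k, -, h⟩ | ⟨d, h, -⟩
    exacts [tr_rem h, tr_listen h, tr_turn h]
  have hturn : ∀ p d, view (c p) = .turn d → e + d = between n q p := by
    intro p d hp
    rcases h p with h | ⟨k, -, h⟩ | ⟨d', h, hd'⟩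
    · rw [hp] at h; cases h
    · rw [hp] at h; cases h
    · rw [hp] at h; cases h; exact hd'
  have hen : e < n := by
    have := hturn p₀ d₀ hp₀
    have := between_lt (q := q) p₀.2
    omega
  have hl : ∀ p k, k ≤ e → view (c p) = .listen k → view (stp p) = .listen (k + 1) := by
    intro p k hk hp
    have : view (stp p) = _ := view_of_listen_silence hp (reception_silence htr)
    -- Newcomers have heard at most e < n < m silent rounds, so none becomes active during the round
    -- robin.
    rwa [if_neg (by omega)] at this
  have ht : ∀ p d, view (c p) = .turn d →
      view (stp p) = if d = 0 then .crit else .turn (d - 1) := fun p d hp =>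
    view_of_turn_silence hp (reception_silence htr)
  have hrem : ∀ p, view (c p) = .rem → view (stp p) = .rem ∨ view (stp p) = .listen 0 :=
    fun p hp => view_of_rem (hg p) hp
  by_cases hw : ∃ p, view (c p) = .turn 0
  · obtain ⟨w, hw⟩ := hw
    have hwb := hturn w 0 hw
    have huniq : ∀ p, view (c p) = .turn 0 → p = w := fun p hp =>
      Fin.ext (between_inj q.2 p.2 w.2 ((hturn p 0 hp).symm.trans hwb))
    have hwv : view (stp w) = .crit := by simpa using ht w 0 hw
    refine ⟨.crit w, ⟨hwv, fun p hp => ?_⟩, fun _ _ => by simp only [rank]; omega,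
      fun p hp => ?_⟩
    · rcases h p with h | ⟨k, hk, h⟩ | ⟨d, h, -⟩
      · rcases hrem p h with h | h <;> simp [h]
      · simp [hl p k hk h]
      · have hd : d ≠ 0 := by rintro rfl; exact hp (huniq p h)
        have := ht p d h
        rw [if_neg hd] at this
        simp [this]
    · by_cases hpw : p = w
      · left; rw [hpw]; exact sec_critical_iff.2 hwv
      right; left
      rcases h p with h | ⟨k, hk, h⟩ | ⟨d, h, hd⟩
      · rw [sec_entry_iff, h] at hp; simp at hp
      · simpa only [major, h] using between_lt p.2
      · have hd0 : d ≠ 0 := by rintro rfl; exact hpw (huniq p h)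
        simp only [major, h]
        -- The process w that enters has the delay e, and p still has a positive countdown, so w
        -- precedes p in the cyclic order from q.
        exact between_lt_between q.2 p.2 (by omega)
  · have ht' : ∀ p d, view (c p) = .turn d → d ≠ 0 ∧ view (stp p) = .turn (d - 1) := by
      intro p d hp
      have hd : d ≠ 0 := by rintro rfl; exact hw ⟨p, hp⟩
      have := ht p d hp
      rw [if_neg hd] at this
      exact ⟨hd, this⟩
    refine ⟨.turns q (e + 1), ⟨fun p => ?_, ⟨p₀, _, (ht' p₀ d₀ hp₀).2⟩⟩,
      fun _ _ => by simp only [rank]; omega,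
      fun p hp => Or.inr (Or.inr ⟨?_, by simp only [minor, rank]; omega⟩)⟩
    · rcases h p with h | ⟨k, hk, h⟩ | ⟨d, h, hd⟩
      · exact (hrem p h).imp id fun h => Or.inl ⟨0, by omega, h⟩
      · exact Or.inr (Or.inl ⟨k + 1, by omega, hl p k hk h⟩)
      · obtain ⟨hd0, hv⟩ := ht' p d h
        exact Or.inr (Or.inr ⟨d - 1, hv, by omega⟩)
    · rcases h p with h | ⟨k, hk, h⟩ | ⟨d, h, hd⟩
      · rw [sec_entry_iff, h] at hp; simp at hp
      · simp [major, h, hl p k hk h]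
      · simp [major, h, (ht' p d h).2]

/-- After a round without a success, the schedules of the active processes are one round further. -/
theorem stepGoal_wake_of_not_success (hg : ∀ p : Fin n, Good p (c p))
    (hs : IsSynchronizer n m s) {τ : ℕ} (h : PhaseInv m s (.wake τ) c)
    (hns : ¬ Success s c τ τ) : StepGoal m s σ (.wake τ) c := by
  obtain ⟨hτ, h, ⟨p₀, hp₀⟩, hhist⟩ := h
  replace hhist : ∀ t < τ + 1, ¬ Success s c τ t := fun t ht => by
    rcases Nat.lt_or_ge t τ with h | h
    · exact hhist t h
    · obtain rfl : t = τ := by omega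
      exact hns
  have hbound : ∀ p i, view (c p) = .active i → i ≤ τ := by
    intro p i hp
    rcases h p with h | ⟨k, -, h⟩ | ⟨j, hj, h⟩
    · rw [hp] at h; cases h
    · rw [hp] at h; cases h
    · rw [hp] at h; cases h; exact hj
  -- Otherwise all m rounds since the first activation were unsuccessful. The synchronizer property,
  -- applied to the active processes with activation rounds τ - i, forbids this.
  have hτm : τ + 1 < m := by
    by_contra hcon
    classical
    let w : Fin n → ℕ := fun p => match view (c p) with
      | .active i => τ - i
      | _ => 0
    have hw : ∀ p i, view (c p) = .active i → w p = τ - i := fun p i hp => by simp [w, hp]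
    obtain ⟨t, ht, p, hp, h1, h2, h3⟩ :=
      hs (Finset.univ.filter fun p => ∃ i, view (c p) = .active i) w
        ⟨p₀, by simp [hp₀], by simp [hw p₀ τ hp₀]⟩
    obtain ⟨i, hi⟩ := (Finset.mem_filter.1 hp).2
    rw [hw p i hi] at h1 h2
    refine hhist t (by omega) ⟨p, i, hi, h1, h2, fun q j hq hj hjt => ?_⟩
    have := h3 q (by simp [hj]) hq
    rw [hw q j hj] at this
    exact this hjt
  have hact : ∀ p i, view (c p) = .active i → transmission (wakeAlg n m s) (c p) =
      if s p i then some (.regular none) else none := fun p i hp => tr_active (hg p) hp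
  have htr : ∀ p x, transmission (wakeAlg n m s) (c p) = some x →
      ∃ i, view (c p) = .active i ∧ s p i = true := by
    intro p x hx
    rcases h p with h | ⟨k, -, h⟩ | ⟨i, -, h⟩
    · rw [tr_rem h] at hx; cases hx
    · rw [tr_listen h] at hx; cases hx
    · refine ⟨i, h, ?_⟩
      rw [hact p i h] at hx
      by_contra hc
      rw [if_neg hc] at hx; cases hx
  have hsil : perceive false (channel (trs)) = .silence := by
    refine perceive_false_eq_silence fun ⟨p, hp, hq⟩ => hns ?_
    obtain ⟨x, hx⟩ := Option.isSome_iff_exists.1 hp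
    obtain ⟨i, hi, hsi⟩ := htr p x hx
    have hle := hbound p i hi
    refine ⟨p, i, hi, by omega, by rwa [Nat.sub_sub_self hle], fun q j hqp hj _ => ?_⟩
    rw [Nat.sub_sub_self (hbound q j hj)]
    have := hq q hqp
    simp only [hact q j hj] at this
    by_contra hc
    rw [if_pos (by simpa using hc)] at this; cases this
  have hr : ∀ p, reception false (trs) p = none ∨ reception false (trs) p = some .silence := by
    intro p
    cases hp : transmission (wakeAlg n m s) (c p) with
    | none => right; rw [reception_of_eq_none (tx := trs) hp, hsil]
    | some x => left; exact reception_of_eq_some (tx := trs) hp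
  have hv : ∀ p i, view (c p) = .active i → view (stp p) = .active (i + 1) := by
    intro p i hp
    have h1 : view (stp p) = _ := view_of_active hp (hr p)
    have := hbound p i hp
    rwa [if_neg (by omega)] at h1
  have hl : ∀ p k, view (c p) = .listen k →
      view (stp p) = if k + 1 = m then .active 0 else .listen (k + 1) := by
    intro p k hp
    refine view_of_listen_silence hp ?_
    rw [reception_of_eq_none (tx := trs) (tr_listen hp), hsil]
  have hrem : ∀ p, view (c p) = .rem → view (stp p) = .rem ∨ view (stp p) = .listen 0 :=
    fun p hp => view_of_rem (hg p) hp
  -- A process activated just now has i = 0 and took no part in earlier rounds; for the others τ - i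
  -- is unchanged. So a past success seen after the step was one already before it.
  have hback : ∀ p i, view (stp p) = .active i → i = 0 ∨ ∃ j, i = j + 1 ∧ view (c p) = .active j := by
    intro p i hp
    rcases h p with h | ⟨k, -, h⟩ | ⟨j, -, h⟩
    · rcases hrem p h with h | h <;> rw [hp] at h <;> cases h
    · have := hl p k h
      rw [hp] at this
      split_ifs at this
      cases this; exact Or.inl rfl
    · have := hv p j h
      rw [hp] at this
      cases this; exact Or.inr ⟨j, rfl, h⟩
  refine ⟨.wake (τ + 1), ⟨hτm, fun p => ?_, ⟨p₀, hv p₀ τ hp₀⟩, fun t ht hsucc => ?_⟩,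
    fun _ _ => by simp only [rank]; omega,
    fun p hp => Or.inr (Or.inr ⟨by simp [major], by simp only [minor, rank]; omega⟩)⟩
  · rcases h p with h | ⟨k, hk, h⟩ | ⟨j, hj, h⟩
    · exact (hrem p h).imp id fun h => Or.inl ⟨0, by omega, h⟩
    · have := hl p k h
      split_ifs at this
      · exact Or.inr (Or.inr ⟨0, by omega, this⟩)
      · exact Or.inr (Or.inl ⟨k + 1, by omega, this⟩)
    · exact Or.inr (Or.inr ⟨j + 1, by omega, hv p j h⟩)
  · obtain ⟨p, i, hi, h1, h2, h3⟩ := hsucc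
    rcases hback p i hi with rfl | ⟨j, rfl, hj⟩
    · omega
    · rw [Nat.add_sub_add_right] at h1 h2
      refine hhist t ht ⟨p, j, hj, h1, h2, fun q j' hq hj' hjt => ?_⟩
      have := h3 q (j' + 1) hq (hv q j' hj')
      rw [Nat.add_sub_add_right] at this
      exact this hjt

/-- Everybody but the lone transmitter hears its message and returns to `listen 0`. The transmitter
goes solo, or enters at once if this was its last round. -/
theorem stepGoal_wake_of_success (hg : ∀ p : Fin n, Good p (c p)) {τ : ℕ}
    (h : PhaseInv m s (.wake τ) c) (hsucc : Success s c τ τ) : StepGoal m s σ (.wake τ) c := by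
  obtain ⟨hτ, h, -, -⟩ := h
  obtain ⟨q, i, hi, -, hq, hoth⟩ := hsucc
  have hbound : ∀ p i, view (c p) = .active i → i ≤ τ := by
    intro p i hp
    rcases h p with h | ⟨k, -, h⟩ | ⟨j, hj, h⟩
    · rw [hp] at h; cases h
    · rw [hp] at h; cases h
    · rw [hp] at h; cases h; exact hj
  have hiτ := hbound q i hi
  rw [Nat.sub_sub_self hiτ] at hq
  have htq : transmission (wakeAlg n m s) (c q) = some (.regular none) := by
    have := tr_active (n := n) (m := m) (s := s) (hg q) hi
    rwa [if_pos hq] at this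
  have htr : ∀ p, p ≠ q → transmission (wakeAlg n m s) (c p) = none := by
    intro p hp
    rcases h p with h | ⟨k, -, h⟩ | ⟨j, hj, h⟩
    · exact tr_rem h
    · exact tr_listen h
    · have h1 := hoth p j hp h (by omega)
      rw [Nat.sub_sub_self hj] at h1
      have := tr_active (n := n) (m := m) (s := s) (hg p) h
      rwa [if_neg (by simp [h1])] at this
  have hqv : view (stp q) = if i + 1 = m then .crit else .active (i + 1) :=
    view_of_active hi (Or.inl (reception_of_eq_some htq))
  have hr : ∀ p, p ≠ q → view (stp p) = .rem ∨ view (stp p) = .listen 0 := by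
    intro p hp
    have hm := reception_message htq htr hp
    rcases h p with h | ⟨k, -, h⟩ | ⟨j, hj, h⟩
    · exact view_of_rem (hg p) h
    · exact Or.inr (view_of_listen_message h hm (Or.inr rfl))
    · exact Or.inr (view_of_active_message h hm)
  by_cases hm : i + 1 = m
  · rw [if_pos hm] at hqv
    refine ⟨.crit q, ⟨hqv, fun p hp => ?_⟩, fun _ _ => by simp only [rank]; omega,
      fun p hp => Or.inr (Or.inl ?_)⟩
    · rcases hr p hp with h | h <;> simp [h]
    · simpa only [major] using between_lt p.2
  · rw [if_neg hm] at hqv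
    exact ⟨.solo q (i + 1), ⟨by omega, hqv, fun p hp =>
      (hr p hp).imp id fun h => ⟨0, by omega, h⟩⟩, fun _ _ => by simp only [rank]; omega,
      fun p hp => Or.inr (Or.inr ⟨by simp [major], by simp only [minor, rank]; omega⟩)⟩

end Step

/-- The bound is one exit round, then at most m rounds each for silence, wake-up and solo. A round
robin takes at most n < m rounds and is covered by it. -/
theorem correct (hs : IsSynchronizer n m s) (hnm : n < m) :
    IsMutex (wakeAlg n m s) false n ∧ IsFair (wakeAlg n m s) false n ∧
      makespan (wakeAlg n m s) false n ≤ (3 * m + 1 : ℕ) := by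
  refine correct_of_phases (Inv m s) (rank m) (fun _ φ c p => major φ c p)
    (fun σ φ c _ => minor m σ φ c) (3 * m + 1) (fun _ _ => rfl) ?_ (.idle 0) ?_ ?_ ?_
  · intro φ
    cases φ <;> simp only [rank] <;> omega
  · exact ⟨fun p => ⟨rfl, fun _ => rfl⟩, by omega, fun p => Or.inl rfl, Or.inl rfl⟩
  · intro φ c p q hφ hp hq
    replace hφ := hφ.2
    rw [sec_critical_iff] at hp hq
    cases φ with
    | idle g => rcases hφ.2.1 p with h | ⟨k, -, h⟩ <;> rw [hp] at h <;> cases h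
    | wake τ =>
      rcases hφ.2.1 p with h | ⟨k, -, h⟩ | ⟨i, -, h⟩ <;> rw [hp] at h <;> cases h
    | solo q' i =>
      by_cases hne : p = q'
      · subst hne
        have := hφ.2.1
        rw [hp] at this; cases this
      · rcases hφ.2.2 p hne with h | ⟨k, -, h⟩ <;> rw [hp] at h <;> cases h
    | turns q' e =>
      rcases hφ.1 p with h | ⟨k, -, h⟩ | ⟨d, h, -⟩ <;> rw [hp] at h <;> cases h
    | crit q' =>
      have : ∀ p, view (c p) = .crit → p = q' := fun p hp => by
        by_contra hne
        rcases hφ.2 p hne with h | ⟨b, h⟩ | ⟨d, h⟩ <;> rw [hp] at h <;> cases h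
      rw [this p hp, this q hq]
    | exit q' =>
      by_cases hne : p = q'
      · subst hne
        have := hφ.1
        rw [hp] at this; cases this
      · rcases hφ.2 p hne with h | h <;> rw [hp] at h <;> cases h
  · intro σ φ c ⟨hg, hφ⟩
    have goal : StepGoal m s σ φ c := by
      cases φ with
      | idle g => exact stepGoal_idle hg hφ
      | wake τ =>
        by_cases hsucc : Success s c τ τ
        · exact stepGoal_wake_of_success hg hφ hsucc
        · exact stepGoal_wake_of_not_success hg hs hφ hsucc
      | solo q i => exact stepGoal_solo hg hφ
      | turns q e => exact stepGoal_turns hg hnm hφ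
      | crit q => exact stepGoal_crit hg hφ
      | exit q => exact stepGoal_exit hg hnm hφ
    obtain ⟨φ', h1, h2, h3⟩ := goal
    exact ⟨φ', ⟨fun p => good_advance (hg p), h1⟩, h2, h3⟩

end Wake

/-! ### Asymptotics and conclusion -/

/-- The size is at most log₂ n + 1 ≤ 2 log₂ n for n ≥ 2, and 2 / log 2 < 3. -/
theorem size_le_log {n : ℕ} (hn : 2 ≤ n) : (n.size : ℝ) ≤ 3 * Real.log n := by
  have h1 : 0 < n.size := Nat.size_pos.2 (by omega)
  have h2 : 2 ^ (n.size - 1) ≤ n := Nat.lt_size.1 (by omega)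
  have h3 : ((n.size : ℝ) - 1) * Real.log 2 ≤ Real.log n := by
    have h : Real.log ((2 : ℝ) ^ (n.size - 1)) ≤ Real.log n :=
      Real.log_le_log (by positivity) (by exact_mod_cast h2)
    rwa [Real.log_pow, Nat.cast_sub h1, Nat.cast_one] at h
  have h4 : Real.log 2 ≤ Real.log n := Real.log_le_log (by norm_num) (by exact_mod_cast hn)
  have h5 := Real.log_two_gt_d9
  have h6 : (1 : ℝ) ≤ n.size := by exact_mod_cast h1
  nlinarith

end MutexMAC

theorem mainTheorem10 :
    (∃ A : MutexMAC.Algorithm,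
      (∀ n : ℕ, MutexMAC.IsMutex A true n ∧ MutexMAC.IsFair A true n ∧
        MutexMAC.makespan A true n ≠ ⊤) ∧
      (fun n : ℕ => ((MutexMAC.makespan A true n).toNat : ℝ)) =O[atTop]
        fun n : ℕ => Real.log n) ∧
    (∃ A : ℕ → MutexMAC.Algorithm,
      (∀ n : ℕ, MutexMAC.IsMutex (A n) false n ∧ MutexMAC.IsFair (A n) false n ∧
        MutexMAC.makespan (A n) false n ≠ ⊤) ∧
      (fun n : ℕ => ((MutexMAC.makespan (A n) false n).toNat : ℝ)) =O[atTop]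
        fun n : ℕ => (n : ℝ) * Real.log n ^ 2) := by
  open MutexMAC in
  constructor
  · refine ⟨electAlg Elect.codeWord Elect.codeLength, fun n => ?_, ?_⟩
    · obtain ⟨h1, h2, h3⟩ := Elect.correct_codeWord n
      exact ⟨h1, h2, ne_top_of_le_ne_top (ENat.natCast_ne_top _) h3⟩
    -- 4·size + 6 ≤ 10·size ≤ 30·log n.
    · refine IsBigO.of_bound 30 ?_
      filter_upwards [eventually_ge_atTop 2] with n hn
      have h1 := ENat.toNat_le_of_le_natCast (Elect.correct_codeWord n).2.2
      have h2 : ((makespan (electAlg Elect.codeWord Elect.codeLength) true n).toNat : ℝ) ≤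
          4 * n.size + 6 := by exact_mod_cast h1
      have h3 := size_le_log hn
      have h4 : (1 : ℝ) ≤ n.size := by exact_mod_cast Nat.size_pos.2 (by omega : 0 < n)
      rw [Real.norm_of_nonneg (Nat.cast_nonneg _), Real.norm_of_nonneg (by linarith)]
      linarith
  · have key : ∀ n : ℕ, ∃ A : Algorithm, IsMutex A false n ∧ IsFair A false n ∧
        makespan A false n ≤ (3 * (128 * n * n.size ^ 2 + 1) + 1 : ℕ) := by
      intro n
      rcases Nat.eq_zero_or_pos n with rfl | hn
      -- For n = 0 the length 128·n·size² would be 0, not larger than n. Length 1 is used instead,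
      -- which explains the `+ 1` in the bound.
      · exact ⟨_, Wake.correct (m := 0 + 1) (s := fun _ _ => false)
          (fun X w ⟨p, _⟩ => p.elim0) (by omega)⟩
      · obtain ⟨s, hs⟩ := exists_synchronizer hn
        have h1 : 1 ≤ n.size ^ 2 := Nat.one_le_pow _ _ (Nat.size_pos.2 hn)
        obtain ⟨h2, h3, h4⟩ := Wake.correct hs (by nlinarith)
        exact ⟨_, h2, h3, h4.trans (by exact_mod_cast (by omega))⟩
    choose A hA using key
    refine ⟨A, fun n => ?_, ?_⟩
    · obtain ⟨h1, h2, h3⟩ := hA n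
      exact ⟨h1, h2, ne_top_of_le_ne_top (ENat.natCast_ne_top _) h3⟩
    -- With S = n·size² ≥ 1, the bound 384·S + 4 is at most 388·S, and size² ≤ 9·log² n gives 388·9
    -- = 3492.
    · refine IsBigO.of_bound 3492 ?_
      filter_upwards [eventually_ge_atTop 2] with n hn
      have h1 := ENat.toNat_le_of_le_natCast (hA n).2.2
      have h2 : ((makespan (A n) false n).toNat : ℝ) ≤ 3 * (128 * n * n.size ^ 2 + 1) + 1 := by
        exact_mod_cast h1
      have h3 := size_le_log hn
      have h4 : (1 : ℝ) ≤ n.size := by exact_mod_cast Nat.size_pos.2 (by omega : 0 < n)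
      have hn1 : (1 : ℝ) ≤ n := by exact_mod_cast (by omega : 1 ≤ n)
      have h5 : (1 : ℝ) ≤ n * n.size ^ 2 := by nlinarith [sq_nonneg ((n.size : ℝ) - 1)]
      have h6 : (n : ℝ) * n.size ^ 2 ≤ n * (3 * Real.log n) ^ 2 := by gcongr
      rw [Real.norm_of_nonneg (Nat.cast_nonneg _), Real.norm_of_nonneg (by positivity)]
      linarith
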